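/- Let $n$ be a non-negative integer or $n=\infty$. Let $\mathbb M_2=\mathbb F_2[\tau,\rho]$ be the mod $2$ motivic (co)homology of a point over $\mathbb R$, graded homologically by (internal degree, weight) with $|\tau|=(0,-1)$ and $|\rho|=(-1,-1)$. Let $E(n)=(\mathbb M_2,\Gamma)$ be the Hopf algebroid with $$\Gamma=\mathbb M_2[\tau_0,\dots,\tau_n]/(\tau_i^2-\rho\tau_{i+1}\ (0\le i<n),\ \tau_n^2),\qquad |\tau_i|=(2^{i+1}-1,2^i-1)$$ (for $n=\infty$: all $\tau_i$ with $i\ge 0$, and the relations $\tau_i^2=\rho\tau_{i+1}$ for all $i$), whose left unit is the inclusion, whose right unit is $\eta_R(\rho)=\rho$, $\eta_R(\tau)=\tau+\rho\tau_0$, and in which every $\tau_i$ is primitive, $\Delta(\tau_i)=\tau_i\otimes 1+1\otimes\tau_i$. Let $\mathrm{Ext}_{E(n)}(\mathbb M_2,\mathbb M_2)$ be the cohomology of its cobar complex, with the product induced by concatenation, trigraded by $(t-s,s,u)$, where $s$ is the cohomological degree, $t$ the internal degree and $u$ the weight. Then there is an isomorphism of $\mathbb F_2$-algebras between $\mathrm{Ext}_{E(n)}(\mathbb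 M_2,\mathbb M_2)$ and the commutative $\mathbb F_2$-algebra generated by $\rho$, $\tau^{2^{n+1}}$ (this generator only if $n<\infty$) and $v_i(j)$ for integers $0\le i\le n$ (all $i\ge 0$ if $n=\infty$), $j\ge 0$, subject to the relations 1. $\rho^{2^{i+1}-1}v_i(j)=0$; 2. $v_i(j)\,v_k(\ell)=v_i(j+2^{k-i}\ell)\,v_k(0)$ whenever $i\le k$; 3. $v_i(j)=\tau^{2^{n+1}}v_i(j-2^{n-i})$ whenever $n<\infty$ and $j\ge 2^{n-i}$. Under this isomorphism the generators $\rho$ and $\tau^{2^{n+1}}$ correspond to the classes of the elements of $\mathbb M_2$ with these names. The class $v_i(j)$ has tridegree $(2^{i+1}-2,\,1,\,2^i-1-2^{i+1}j)$, and it is represented by $\tau^{2^{i+1}j}v_i$ on the $E_1$-page of the $\rho$-Bockstein spectral sequence (the one given by filtering the cobar complex by powers of $\rho$), where $v_i$ denotes the class of the cobar element $[\tau_i]$: that is, $v_i(j)$ has a representing cocycle that is congruent modulo $\rho$, up to a coboundary, to $\tau^{2^{i+1}j}[\tau_i]$. -/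

import Mathlib

open scoped TensorProduct

noncomputable section

namespace RealMotivic

/-! ### The coefficient ring and the Hopf algebroid `E(n)` -/

/-- The two polynomial generators of the motivic cohomology of a point over `ℝ`. -/
inductive PtGen : Type
  | tau
  | rho

/-- `𝕄₂ = 𝔽₂[τ, ρ]`. -/
abbrev M2 : Type := MvPolynomial PtGen (ZMod 2)

def tau : M2 := MvPolynomial.X PtGen.tau

def rho : M2 := MvPolynomial.X PtGen.rho

/-- The relations `τ_i ^ 2 = ρ τ_{i+1}` for all `i`, together with `τ_i = 0` for `i > n`.
For finite `n` this leaves the generators `τ_0, …, τ_n`, with `τ_i ^ 2 = ρ τ_{i+1}` for `i < n`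
and `τ_n ^ 2 = 0`; for `n = ∞` nothing is set to zero. -/
def gammaRel (n : ℕ∞) : Set (MvPolynomial ℕ M2) :=
  {p | (∃ i : ℕ, p = MvPolynomial.X i ^ 2 - MvPolynomial.C rho * MvPolynomial.X (i + 1)) ∨
    ∃ i : ℕ, n < (i : ℕ∞) ∧ p = MvPolynomial.X i}

/-- The ring of the Hopf algebroid `E(n)` over `𝕄₂`,
`𝕄₂[τ_0, …, τ_n] / (τ_i ^ 2 - ρ τ_{i+1}, τ_n ^ 2)`. Its `M2`-algebra structure is the left unit. -/
def Gamma (n : ℕ∞) : Type := MvPolynomial ℕ M2 ⧸ Ideal.span (gammaRel n)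

instance instCommRingGamma (n : ℕ∞) : CommRing (Gamma n) :=
  inferInstanceAs (CommRing (MvPolynomial ℕ M2 ⧸ Ideal.span (gammaRel n)))

instance instAlgebraGamma (n : ℕ∞) : Algebra M2 (Gamma n) :=
  inferInstanceAs (Algebra M2 (MvPolynomial ℕ M2 ⧸ Ideal.span (gammaRel n)))

instance instAlgebraZModGamma (n : ℕ∞) : Algebra (ZMod 2) (Gamma n) :=
  inferInstanceAs (Algebra (ZMod 2) (MvPolynomial ℕ M2 ⧸ Ideal.span (gammaRel n)))

instance instIsScalarTowerGamma (n : ℕ∞) : IsScalarTower (ZMod 2) M2 (Gamma n) :=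
  inferInstanceAs (IsScalarTower (ZMod 2) M2 (MvPolynomial ℕ M2 ⧸ Ideal.span (gammaRel n)))

/-- The quotient map from the polynomial ring. -/
def gammaMk (n : ℕ∞) : MvPolynomial ℕ M2 →+* Gamma n :=
  Ideal.Quotient.mk (Ideal.span (gammaRel n))

/-- The element `τ_i` (it is zero if `i > n`). -/
def tauG (n : ℕ∞) (i : ℕ) : Gamma n := gammaMk n (MvPolynomial.X i)

/-- The left unit. -/
def etaL (n : ℕ∞) : M2 →ₐ[ZMod 2] Gamma n := IsScalarTower.toAlgHom (ZMod 2) M2 (Gamma n)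

/-- The right unit: `η_R(τ) = τ + ρ τ_0`, `η_R(ρ) = ρ`. -/
def etaR (n : ℕ∞) : M2 →ₐ[ZMod 2] Gamma n :=
  MvPolynomial.aeval fun g => match g with
    | PtGen.tau => etaL n tau + etaL n rho * tauG n 0
    | PtGen.rho => etaL n rho

/-- A copy of `Gamma n`, regarded as an `𝕄₂`-algebra through the right unit. -/
def RightGamma (n : ℕ∞) : Type := Gamma n

instance instCommRingRightGamma (n : ℕ∞) : CommRing (RightGamma n) :=
  inferInstanceAs (CommRing (Gamma n))

instance instAlgebraRightGamma (n : ℕ∞) : Algebra M2 (RightGamma n) :=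
  RingHom.toAlgebra (S := RightGamma n) (etaR n).toRingHom

/-- The identity of `Gamma n`, with the structure on the target changed. -/
def toRight (n : ℕ∞) : Gamma n →+* RightGamma n := RingHom.id (Gamma n)

/-- `Γ ⊗_{𝕄₂} Γ`, the tensor product of bimodules: the right unit of the left factor is
identified with the left unit of the right factor. -/
abbrev GammaTwo (n : ℕ∞) : Type := RightGamma n ⊗[M2] Gamma n

/-- `x ↦ x ⊗ 1`. -/
def inFst (n : ℕ∞) : Gamma n →+* GammaTwo n :=
  (Algebra.TensorProduct.includeLeftRingHom).comp (toRight n)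

/-- `x ↦ 1 ⊗ x`. -/
def inSnd (n : ℕ∞) : Gamma n →+* GammaTwo n :=
  (Algebra.TensorProduct.includeRight : Gamma n →ₐ[M2] GammaTwo n).toRingHom

theorem etaR_tau (n : ℕ∞) : etaR n tau = etaL n tau + etaL n rho * tauG n 0 := by
  simp [etaR, tau]

theorem etaR_rho (n : ℕ∞) : etaR n rho = etaL n rho := by
  simp [etaR, rho]

theorem inFst_etaR (n : ℕ∞) (a : M2) : inFst n (etaR n a) = inSnd n (etaL n a) := by
  have h1 : inFst n (etaR n a) = algebraMap M2 (RightGamma n) a ⊗ₜ[M2] (1 : Gamma n) := rfl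
  have h2 : inSnd n (etaL n a) = (1 : RightGamma n) ⊗ₜ[M2] algebraMap M2 (Gamma n) a := rfl
  rw [h1, h2, Algebra.algebraMap_eq_smul_one, Algebra.algebraMap_eq_smul_one,
    TensorProduct.smul_tmul]

theorem tauG_sq (n : ℕ∞) (i : ℕ) : tauG n i ^ 2 = etaL n rho * tauG n (i + 1) := by
  have h : gammaMk n
      (MvPolynomial.X i ^ 2 - MvPolynomial.C rho * MvPolynomial.X (i + 1)) = 0 :=
    Ideal.Quotient.eq_zero_iff_mem.2 (Ideal.subset_span (Or.inl ⟨i, rfl⟩))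
  rw [map_sub, map_pow, map_mul, sub_eq_zero] at h
  exact h

theorem tauG_eq_zero (n : ℕ∞) (i : ℕ) (h : n < (i : ℕ∞)) : tauG n i = 0 :=
  Ideal.Quotient.eq_zero_iff_mem.2 (Ideal.subset_span (Or.inr ⟨i, h, rfl⟩))

theorem gammaTwo_two (n : ℕ∞) : (2 : GammaTwo n) = 0 := by
  have h : (2 : ZMod 2) = 0 := by decide
  have h2 : (2 : Gamma n) = 0 := by
    have := congrArg (algebraMap (ZMod 2) (Gamma n)) h
    rwa [map_ofNat, map_zero] at this
  have := congrArg (inSnd n) h2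
  rwa [map_ofNat, map_zero] at this

/-- The coproduct before passing to the quotient: `a ↦ a ⊗ 1`, `τ_i ↦ τ_i ⊗ 1 + 1 ⊗ τ_i`. -/
def comulPre (n : ℕ∞) : MvPolynomial ℕ M2 →+* GammaTwo n :=
  MvPolynomial.eval₂Hom ((inFst n).comp (etaL n).toRingHom)
    fun i => inFst n (tauG n i) + inSnd n (tauG n i)

theorem comulPre_rel (n : ℕ∞) (p : MvPolynomial ℕ M2) (hp : p ∈ Ideal.span (gammaRel n)) :
    comulPre n p = 0 := by
  suffices h : Ideal.span (gammaRel n) ≤ RingHom.ker (comulPre n) from h hp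
  rw [Ideal.span_le]
  rintro q (⟨i, rfl⟩ | ⟨i, hi, rfl⟩)
  · have key : (inFst n (tauG n i) + inSnd n (tauG n i)) ^ 2 =
        inFst n (etaL n rho) * (inFst n (tauG n (i + 1)) + inSnd n (tauG n (i + 1))) := by
      have e1 : inFst n (tauG n i) ^ 2 = inFst n (etaL n rho) * inFst n (tauG n (i + 1)) := by
        rw [← map_pow, tauG_sq, map_mul]
      have e2 : inSnd n (tauG n i) ^ 2 = inFst n (etaL n rho) * inSnd n (tauG n (i + 1)) := by
        rw [← map_pow, tauG_sq, map_mul, ← inFst_etaR, etaR_rho]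
      rw [add_sq, gammaTwo_two, e1, e2]
      ring
    simp only [SetLike.mem_coe, RingHom.mem_ker, map_sub, map_mul, map_pow]
    simp only [comulPre, MvPolynomial.coe_eval₂Hom, MvPolynomial.eval₂_X, MvPolynomial.eval₂_C]
    rw [key]
    exact sub_self _
  · simp only [SetLike.mem_coe, RingHom.mem_ker, comulPre, MvPolynomial.coe_eval₂Hom,
      MvPolynomial.eval₂_X, tauG_eq_zero n i hi, map_zero, add_zero]

/-- The coproduct `Δ : Γ → Γ ⊗_{𝕄₂} Γ`, the ring homomorphism with `Δ(a) = a ⊗ 1` for `a ∈ 𝕄₂`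
(left unit) and `Δ(τ_i) = τ_i ⊗ 1 + 1 ⊗ τ_i`. -/
def comul (n : ℕ∞) : Gamma n →+* GammaTwo n :=
  Ideal.Quotient.lift (Ideal.span (gammaRel n)) (comulPre n) (comulPre_rel n)

theorem comul_tauG (n : ℕ∞) (i : ℕ) :
    comul n (tauG n i) = inFst n (tauG n i) + inSnd n (tauG n i) := by
  change comulPre n (MvPolynomial.X i) = _
  simp [comulPre]

theorem comul_etaL (n : ℕ∞) (a : M2) : comul n (etaL n a) = inFst n (etaL n a) := by
  change comulPre n (MvPolynomial.C a) = _
  simp [comulPre]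

theorem comul_etaR (n : ℕ∞) (a : M2) : comul n (etaR n a) = inSnd n (etaR n a) := by
  have h : (comul n).comp (etaR n).toRingHom = (inSnd n).comp (etaR n).toRingHom := by
    apply MvPolynomial.ringHom_ext
    · intro r
      exact congrArg (fun f : ZMod 2 →+* GammaTwo n => f r)
        (Subsingleton.elim
          (((comul n).comp (etaR n).toRingHom).comp MvPolynomial.C)
          (((inSnd n).comp (etaR n).toRingHom).comp MvPolynomial.C))
    · rintro (_ | _)
      · change comul n (etaR n tau) = inSnd n (etaR n tau)
        have h1 := inFst_etaR n tau
        have h2 := inFst_etaR n rho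
        rw [etaR_tau, map_add, map_mul] at h1
        rw [etaR_rho] at h2
        rw [etaR_tau]
        simp only [map_add, map_mul, comul_etaL, comul_tauG]
        rw [mul_add, ← add_assoc, h1, h2]
      · change comul n (etaR n rho) = inSnd n (etaR n rho)
        rw [etaR_rho, comul_etaL, ← inFst_etaR, etaR_rho]
  exact congrArg (fun f : M2 →+* GammaTwo n => f a) h

/-! ### The cobar complex

The cobar complex `⨁_s Γ ⊗_{𝕄₂} ⋯ ⊗_{𝕄₂} Γ` (`s` factors) with its concatenation product is the
tensor ring of the `𝕄₂`-bimodule `Γ`: the universal `𝔽₂`-algebra with an algebra homomorphism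
from `𝕄₂` and a map of `𝕄₂`-bimodules from `Γ`. -/

/-- The relations that make `a ↦ ι (a, 0)` a ring homomorphism and `g ↦ ι (0, g)` a map of
bimodules. -/
inductive CobarRel (n : ℕ∞) : TensorAlgebra (ZMod 2) (M2 × Gamma n) →
    TensorAlgebra (ZMod 2) (M2 × Gamma n) → Prop
  | one : CobarRel n (TensorAlgebra.ι (ZMod 2) ((1 : M2), (0 : Gamma n))) 1
  | mul (a b : M2) : CobarRel n
      (TensorAlgebra.ι (ZMod 2) (a, (0 : Gamma n)) * TensorAlgebra.ι (ZMod 2) (b, (0 : Gamma n)))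
      (TensorAlgebra.ι (ZMod 2) (a * b, (0 : Gamma n)))
  | left (a : M2) (g : Gamma n) : CobarRel n
      (TensorAlgebra.ι (ZMod 2) (a, (0 : Gamma n)) * TensorAlgebra.ι (ZMod 2) ((0 : M2), g))
      (TensorAlgebra.ι (ZMod 2) ((0 : M2), etaL n a * g))
  | right (g : Gamma n) (a : M2) : CobarRel n
      (TensorAlgebra.ι (ZMod 2) ((0 : M2), g) * TensorAlgebra.ι (ZMod 2) (a, (0 : Gamma n)))
      (TensorAlgebra.ι (ZMod 2) ((0 : M2), etaR n a * g))

/-- The (unreduced) cobar complex of `E(n)`, with the concatenation product. -/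
abbrev Cobar (n : ℕ∞) : Type := RingQuot (CobarRel n)

def ofPair (n : ℕ∞) : M2 × Gamma n →ₗ[ZMod 2] Cobar n :=
  (RingQuot.mkAlgHom (ZMod 2) (CobarRel n)).toLinearMap ∘ₗ TensorAlgebra.ι (ZMod 2)

/-- The elements of cohomological degree `0`. -/
def of0 (n : ℕ∞) : M2 →ₗ[ZMod 2] Cobar n := ofPair n ∘ₗ LinearMap.inl (ZMod 2) M2 (Gamma n)

/-- The elements `[g]` of cohomological degree `1`. The cochain `[g_1|⋯|g_s]` is the product
`of1 n g_1 * ⋯ * of1 n g_s`. -/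
def of1 (n : ℕ∞) : Gamma n →ₗ[ZMod 2] Cobar n := ofPair n ∘ₗ LinearMap.inr (ZMod 2) M2 (Gamma n)

theorem of0_one (n : ℕ∞) : of0 n 1 = 1 := by
  have h := RingQuot.mkAlgHom_rel (ZMod 2) (CobarRel.one (n := n))
  rw [map_one] at h
  exact h

theorem of0_mul (n : ℕ∞) (a b : M2) : of0 n a * of0 n b = of0 n (a * b) := by
  have h := RingQuot.mkAlgHom_rel (ZMod 2) (CobarRel.mul (n := n) a b)
  rw [map_mul] at h
  exact h

theorem of0_mul_of1 (n : ℕ∞) (a : M2) (g : Gamma n) :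
    of0 n a * of1 n g = of1 n (etaL n a * g) := by
  have h := RingQuot.mkAlgHom_rel (ZMod 2) (CobarRel.left (n := n) a g)
  rw [map_mul] at h
  exact h

theorem of1_mul_of0 (n : ℕ∞) (g : Gamma n) (a : M2) :
    of1 n g * of0 n a = of1 n (etaR n a * g) := by
  have h := RingQuot.mkAlgHom_rel (ZMod 2) (CobarRel.right (n := n) g a)
  rw [map_mul] at h
  exact h

/-- The map `Γ ⊗_{𝕄₂} Γ → Cobar n`, `g ⊗ h ↦ [g|h]`. -/
def ofTwo (n : ℕ∞) : GammaTwo n →+ Cobar n :=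
  TensorProduct.liftAddHom
    ((AddMonoidHom.mul (R := Cobar n)).compl₂ (of1 n).toAddMonoidHom |>.comp
      (of1 n).toAddMonoidHom)
    (by
      intro a (g : Gamma n) h
      change of1 n (etaR n a * g) * of1 n h = of1 n g * of1 n (a • h)
      rw [← of1_mul_of0, mul_assoc, of0_mul_of1, Algebra.smul_def]
      rfl)

theorem ofTwo_tmul (n : ℕ∞) (g h : Gamma n) :
    ofTwo n (inFst n g * inSnd n h) = of1 n g * of1 n h := by
  have e : inFst n g * inSnd n h = (toRight n g) ⊗ₜ[M2] h := by
    change (toRight n g ⊗ₜ[M2] (1 : Gamma n)) * ((1 : RightGamma n) ⊗ₜ[M2] h) = _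
    rw [Algebra.TensorProduct.tmul_mul_tmul, mul_one, one_mul]
  rw [e]
  rfl

theorem gammaTwo_induction (n : ℕ∞) {P : GammaTwo n → Prop} (h0 : P 0)
    (ht : ∀ g h : Gamma n, P (inFst n g * inSnd n h))
    (ha : ∀ x y, P x → P y → P (x + y)) (x : GammaTwo n) : P x := by
  induction x using TensorProduct.induction_on with
  | zero => exact h0
  | add x y hx hy => exact ha x y hx hy
  | tmul g h =>
    have e : inFst n (g : Gamma n) * inSnd n h = g ⊗ₜ[M2] h := by
      change ((g : RightGamma n) ⊗ₜ[M2] (1 : Gamma n)) * ((1 : RightGamma n) ⊗ₜ[M2] h) = _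
      rw [Algebra.TensorProduct.tmul_mul_tmul, mul_one, one_mul]
    rw [← e]
    exact ht g h

theorem ofTwo_inFst_mul (n : ℕ∞) (a : M2) (x : GammaTwo n) :
    ofTwo n (inFst n (etaL n a) * x) = of0 n a * ofTwo n x := by
  induction x using gammaTwo_induction n with
  | h0 => simp
  | ha x y hx hy => rw [mul_add, map_add, map_add, mul_add, hx, hy]
  | ht g h => rw [← mul_assoc, ← map_mul, ofTwo_tmul, ofTwo_tmul, ← of0_mul_of1, mul_assoc]

theorem ofTwo_inSnd_mul (n : ℕ∞) (a : M2) (x : GammaTwo n) :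
    ofTwo n (inSnd n (etaR n a) * x) = ofTwo n x * of0 n a := by
  induction x using gammaTwo_induction n with
  | h0 => simp
  | ha x y hx hy => rw [mul_add, map_add, map_add, add_mul, hx, hy]
  | ht g h =>
    rw [mul_left_comm, ← map_mul, ofTwo_tmul, ofTwo_tmul, ← of1_mul_of0, mul_assoc]

/-- The cobar differential on generators: `d(a) = [η_R(a) - η_L(a)]` for `a ∈ 𝕄₂`, and
`d[g] = [1|g] - [Δ g] + [g|1]` for `g ∈ Γ`. -/
def diffGen (n : ℕ∞) : M2 × Gamma n →ₗ[ZMod 2] Cobar n :=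
  LinearMap.coprod
    (of1 n ∘ₗ ((etaR n).toLinearMap - (etaL n).toLinearMap))
    (AddMonoidHom.toZModLinearMap 2
      ((AddMonoidHom.mulLeft (of1 n 1)).comp (of1 n).toAddMonoidHom
        - (ofTwo n).comp (comul n).toAddMonoidHom
        + (AddMonoidHom.mulRight (of1 n 1)).comp (of1 n).toAddMonoidHom))

theorem diffGen_inl (n : ℕ∞) (a : M2) :
    diffGen n (a, 0) = of1 n (etaR n a - etaL n a) := by
  simp [diffGen]

theorem diffGen_inr (n : ℕ∞) (g : Gamma n) :
    diffGen n (0, g) = of1 n 1 * of1 n g - ofTwo n (comul n g) + of1 n g * of1 n 1 := by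
  simp [diffGen]

theorem cobar_add_self (n : ℕ∞) (x : Cobar n) : x + x = 0 := by
  have h : (2 : ZMod 2) • x = 0 := by
    rw [show (2 : ZMod 2) = 0 from by decide, zero_smul]
  rwa [two_smul] at h

theorem cobar_sub (n : ℕ∞) (x y : Cobar n) : x - y = x + y := by
  rw [sub_eq_iff_eq_add, add_assoc, cobar_add_self, add_zero]

/-- The map `x ↦ x + ε d(x)` on generators. -/
def diffPair (n : ℕ∞) : M2 × Gamma n →ₗ[ZMod 2] DualNumber (Cobar n) where
  toFun p := TrivSqZeroExt.inl (ofPair n p) + TrivSqZeroExt.inr (diffGen n p)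
  map_add' p q := by
    ext <;> simp
  map_smul' c p := by
    ext <;> simp

theorem fst_diffPair (n : ℕ∞) (p : M2 × Gamma n) :
    TrivSqZeroExt.fst (diffPair n p) = ofPair n p := by
  simp [diffPair]

theorem snd_diffPair (n : ℕ∞) (p : M2 × Gamma n) :
    TrivSqZeroExt.snd (diffPair n p) = diffGen n p := by
  simp [diffPair]

theorem ofPair_inl (n : ℕ∞) (a : M2) : ofPair n (a, 0) = of0 n a := rfl

theorem ofPair_inr (n : ℕ∞) (g : Gamma n) : ofPair n (0, g) = of1 n g := rfl

theorem diffPair_rel (n : ℕ∞) (x y : TensorAlgebra (ZMod 2) (M2 × Gamma n))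
    (h : CobarRel n x y) :
    TensorAlgebra.lift (ZMod 2) (diffPair n) x = TensorAlgebra.lift (ZMod 2) (diffPair n) y := by
  have hL : ∀ a : M2, of1 n (etaL n a) = of0 n a * of1 n 1 := fun a => by
    rw [of0_mul_of1, mul_one]
  have hR : ∀ a : M2, of1 n (etaR n a) = of1 n 1 * of0 n a := fun a => by
    rw [of1_mul_of0, mul_one]
  cases h with
  | one =>
    simp only [TensorAlgebra.lift_ι_apply, map_one]
    refine TrivSqZeroExt.ext ?_ ?_
    · rw [fst_diffPair, ofPair_inl, of0_one, TrivSqZeroExt.fst_one]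
    · rw [snd_diffPair, diffGen_inl, map_one, map_one, sub_self, map_zero,
        TrivSqZeroExt.snd_one]
  | mul a b =>
    simp only [TensorAlgebra.lift_ι_apply, map_mul]
    refine TrivSqZeroExt.ext ?_ ?_
    · rw [TrivSqZeroExt.fst_mul, fst_diffPair, fst_diffPair, fst_diffPair, ofPair_inl, ofPair_inl,
        ofPair_inl, of0_mul]
    · rw [TrivSqZeroExt.snd_mul]
      simp only [fst_diffPair, snd_diffPair, ofPair_inl, diffGen_inl, smul_eq_mul,
        MulOpposite.smul_eq_mul_unop, MulOpposite.unop_op, map_sub, hL, hR, ← of0_mul, mul_sub,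
        sub_mul, mul_assoc]
      abel
  | left a g =>
    simp only [TensorAlgebra.lift_ι_apply, map_mul]
    refine TrivSqZeroExt.ext ?_ ?_
    · rw [TrivSqZeroExt.fst_mul, fst_diffPair, fst_diffPair, fst_diffPair, ofPair_inl, ofPair_inr,
        ofPair_inr, of0_mul_of1]
    · rw [TrivSqZeroExt.snd_mul]
      simp only [fst_diffPair, snd_diffPair, ofPair_inl, ofPair_inr, diffGen_inl, diffGen_inr,
        smul_eq_mul, MulOpposite.smul_eq_mul_unop, MulOpposite.unop_op, map_sub, hL, hR,
        map_mul, comul_etaL, ofTwo_inFst_mul, ← of0_mul_of1, mul_sub, mul_add,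
        sub_mul, mul_assoc]
      abel
  | right g a =>
    simp only [TensorAlgebra.lift_ι_apply, map_mul]
    refine TrivSqZeroExt.ext ?_ ?_
    · rw [TrivSqZeroExt.fst_mul, fst_diffPair, fst_diffPair, fst_diffPair, ofPair_inl, ofPair_inr,
        ofPair_inr, of1_mul_of0]
    · rw [TrivSqZeroExt.snd_mul]
      simp only [fst_diffPair, snd_diffPair, ofPair_inl, ofPair_inr, diffGen_inl, diffGen_inr,
        smul_eq_mul, MulOpposite.smul_eq_mul_unop, MulOpposite.unop_op, map_sub, hL, hR,
        map_mul, comul_etaR, ofTwo_inSnd_mul, ← of1_mul_of0, mul_sub, add_mul,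
        sub_mul, mul_assoc]
      simp only [cobar_sub]
      have h3 : ∀ p q r t : Cobar n, p + t + (q + r + p) = q + r + t + (p + p) :=
        fun p q r t => by abel
      rw [h3, cobar_add_self n (of1 n g * (of1 n 1 * of0 n a)), add_zero]

/-- The algebra homomorphism `x ↦ x + ε d(x)` that extends `diffGen` to a derivation
(there are no signs, since the characteristic is `2`). -/
def diffHom (n : ℕ∞) : Cobar n →ₐ[ZMod 2] DualNumber (Cobar n) :=
  RingQuot.liftAlgHom (ZMod 2)
    ⟨TensorAlgebra.lift (ZMod 2) (diffPair n), fun x y h => diffPair_rel n x y h⟩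

/-- The cobar differential. -/
def diff (n : ℕ∞) : Cobar n →ₗ[ZMod 2] Cobar n where
  toFun x := TrivSqZeroExt.snd (diffHom n x)
  map_add' x y := by simp
  map_smul' c x := by simp

theorem diffHom_ofPair (n : ℕ∞) (p : M2 × Gamma n) : diffHom n (ofPair n p) = diffPair n p := by
  simp [diffHom, ofPair]

theorem fst_diffHom (n : ℕ∞) (x : Cobar n) : TrivSqZeroExt.fst (diffHom n x) = x := by
  have h : (TrivSqZeroExt.fstHom (ZMod 2) (Cobar n) (Cobar n)).comp (diffHom n) =
      AlgHom.id (ZMod 2) (Cobar n) := by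
    apply RingQuot.ringQuot_ext'
    apply TensorAlgebra.hom_ext
    apply LinearMap.ext
    intro p
    exact (congrArg TrivSqZeroExt.fst (diffHom_ofPair n p)).trans (fst_diffPair n p)
  exact congrArg (fun f : Cobar n →ₐ[ZMod 2] Cobar n => f x) h

theorem diff_mul (n : ℕ∞) (x y : Cobar n) : diff n (x * y) = x * diff n y + diff n x * y := by
  change TrivSqZeroExt.snd (diffHom n (x * y)) = _
  rw [map_mul, TrivSqZeroExt.snd_mul, fst_diffHom, fst_diffHom]
  rfl

theorem diff_of0 (n : ℕ∞) (a : M2) : diff n (of0 n a) = of1 n (etaR n a - etaL n a) := by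
  change TrivSqZeroExt.snd (diffHom n (ofPair n (a, 0))) = _
  rw [diffHom_ofPair, snd_diffPair, diffGen_inl]

theorem diff_of1 (n : ℕ∞) (g : Gamma n) :
    diff n (of1 n g) = of1 n 1 * of1 n g - ofTwo n (comul n g) + of1 n g * of1 n 1 := by
  change TrivSqZeroExt.snd (diffHom n (ofPair n (0, g))) = _
  rw [diffHom_ofPair, snd_diffPair, diffGen_inr]

theorem diff_one (n : ℕ∞) : diff n 1 = 0 := by
  rw [← of0_one, diff_of0, map_one, map_one, sub_self, map_zero]

/-! ### `Ext` over `E(n)` -/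

/-- The cocycles. -/
def cocycles (n : ℕ∞) : Subalgebra (ZMod 2) (Cobar n) where
  carrier := {x | diff n x = 0}
  mul_mem' {x y} hx hy := by
    change diff n (x * y) = 0
    rw [diff_mul, show diff n y = 0 from hy, show diff n x = 0 from hx, mul_zero, zero_mul,
      add_zero]
  add_mem' {x y} hx hy := by
    change diff n (x + y) = 0
    rw [map_add, show diff n y = 0 from hy, show diff n x = 0 from hx, add_zero]
  algebraMap_mem' r := by
    change diff n (algebraMap (ZMod 2) (Cobar n) r) = 0
    rw [Algebra.algebraMap_eq_smul_one, map_smul, diff_one, smul_zero]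

/-- Two cocycles are identified if they differ by a coboundary. -/
def cohomologous (n : ℕ∞) : RingCon (cocycles n) where
  r x y := ∃ w : Cobar n, (x : Cobar n) - y = diff n w
  iseqv :=
    { refl := fun x => ⟨0, by rw [sub_self, map_zero]⟩
      symm := fun {x y} ⟨w, hw⟩ => ⟨-w, by rw [map_neg, ← hw, neg_sub]⟩
      trans := fun {x y z} ⟨w, hw⟩ ⟨w', hw'⟩ => ⟨w + w', by
        rw [map_add, ← hw, ← hw', sub_add_sub_cancel]⟩ }
  add' := fun {x y z t} ⟨w, hw⟩ ⟨w', hw'⟩ => ⟨w + w', by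
    rw [map_add, ← hw, ← hw', Subalgebra.coe_add, Subalgebra.coe_add, add_sub_add_comm]⟩
  mul' := fun {x y z t} ⟨w, hw⟩ ⟨w', hw'⟩ => ⟨w * z + y * w', by
    rw [map_add, diff_mul, diff_mul, show diff n (z : Cobar n) = 0 from z.2,
      show diff n (y : Cobar n) = 0 from y.2, mul_zero, zero_add, zero_mul, add_zero, ← hw, ← hw',
      Subalgebra.coe_mul, Subalgebra.coe_mul, sub_mul, mul_sub, sub_add_sub_cancel]⟩

/-- `Ext_{E(n)}(𝕄₂, 𝕄₂)` as an `𝔽₂`-algebra: the cohomology of the cobar complex, with the product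
induced by concatenation (the direct sum over all cohomological and internal degrees). -/
abbrev Ext (n : ℕ∞) : Type := (cohomologous n).Quotient

/-- The cochain `z` is a cocycle and its class is `x`. -/
def Represents (n : ℕ∞) (z : Cobar n) (x : Ext n) : Prop :=
  ∃ h : z ∈ cocycles n, ((⟨z, h⟩ : cocycles n) : Ext n) = x

/-! ### Tridegrees -/

/-- `GammaHomog n t u g`: the element `g` of `Γ` is homogeneous of bidegree `(t, u)`, where
`|τ| = (0, -1)`, `|ρ| = (-1, -1)` and `|τ_i| = (2 ^ (i+1) - 1, 2 ^ i - 1)` (homological grading). -/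
inductive GammaHomog (n : ℕ∞) : ℤ → ℤ → Gamma n → Prop
  | zero (t u : ℤ) : GammaHomog n t u 0
  | one : GammaHomog n 0 0 1
  | tau : GammaHomog n 0 (-1) (etaL n tau)
  | rho : GammaHomog n (-1) (-1) (etaL n rho)
  | tauG (i : ℕ) : GammaHomog n (2 ^ (i + 1) - 1) (2 ^ i - 1) (tauG n i)
  | add {t u : ℤ} {g h : Gamma n} :
      GammaHomog n t u g → GammaHomog n t u h → GammaHomog n t u (g + h)
  | mul {t u t' u' : ℤ} {g h : Gamma n} :
      GammaHomog n t u g → GammaHomog n t' u' h → GammaHomog n (t + t') (u + u') (g * h)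

/-- `CobarHomog n s t u x`: the cochain `x` is homogeneous of cohomological degree `s`, internal
degree `t` and weight `u`. -/
inductive CobarHomog (n : ℕ∞) : ℕ → ℤ → ℤ → Cobar n → Prop
  | zero (s : ℕ) (t u : ℤ) : CobarHomog n s t u 0
  | one : CobarHomog n 0 0 0 1
  | tau : CobarHomog n 0 0 (-1) (of0 n tau)
  | rho : CobarHomog n 0 (-1) (-1) (of0 n rho)
  | of1 {t u : ℤ} {g : Gamma n} : GammaHomog n t u g → CobarHomog n 1 t u (of1 n g)
  | add {s : ℕ} {t u : ℤ} {x y : Cobar n} :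
      CobarHomog n s t u x → CobarHomog n s t u y → CobarHomog n s t u (x + y)
  | mul {s s' : ℕ} {t u t' u' : ℤ} {x y : Cobar n} :
      CobarHomog n s t u x → CobarHomog n s' t' u' y →
        CobarHomog n (s + s') (t + t') (u + u') (x * y)

/-- The class `x` has tridegree `(t - s, s, u) = (stem, s, u)`. -/
def HasTridegree (n : ℕ∞) (stem : ℤ) (s : ℕ) (u : ℤ) (x : Ext n) : Prop :=
  ∃ z : Cobar n, CobarHomog n s (stem + s) u z ∧ Represents n z x

/-! ### Detection on the `E_1`-page of the `ρ`-Bockstein spectral sequence -/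

/-- The spectral sequence comes from the filtration of the cobar complex by powers of the central
invariant element `ρ`; its `E_1`-page in filtration `0` is the cohomology of the cobar complex
modulo `ρ`, that is, `Ext` over `E(n)^ℂ`. The class `x` is represented there by the class of the
cochain `y` if some cocycle representing `x` is cohomologous to `y` modulo `ρ`. -/
def DetectedBy (n : ℕ∞) (x : Ext n) (y : Cobar n) : Prop :=
  ∃ z : Cobar n, Represents n z x ∧ ∃ w c : Cobar n, z - y = diff n w + of0 n rho * c

/-! ### The presented algebra -/

/-- The generators `ρ`, `τ^{2^{n+1}}` (only for `n` finite) and `v_i(j)`,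
`0 ≤ i ≤ n`, `0 ≤ j`. -/
inductive Gen (n : ℕ∞) : Type
  | rho
  | tauPow (hn : n ≠ ⊤)
  | v (i : ℕ) (hi : (i : ℕ∞) ≤ n) (j : ℕ)

/-- The polynomial algebra on the generators. -/
abbrev Free (n : ℕ∞) : Type := MvPolynomial (Gen n) (ZMod 2)

/-- The relations (each listed polynomial is set to zero). -/
inductive PresRel (n : ℕ∞) : Free n → Prop
  | torsion (i : ℕ) (hi : (i : ℕ∞) ≤ n) (j : ℕ) :
      PresRel n (MvPolynomial.X Gen.rho ^ (2 ^ (i + 1) - 1) * MvPolynomial.X (Gen.v i hi j))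
  | product (i k : ℕ) (hi : (i : ℕ∞) ≤ n) (hk : (k : ℕ∞) ≤ n) (hik : i ≤ k) (j l : ℕ) :
      PresRel n (MvPolynomial.X (Gen.v i hi j) * MvPolynomial.X (Gen.v k hk l) -
        MvPolynomial.X (Gen.v i hi (j + 2 ^ (k - i) * l)) * MvPolynomial.X (Gen.v k hk 0))
  | periodic (hn : n ≠ ⊤) (i : ℕ) (hi : (i : ℕ∞) ≤ n) (j : ℕ) (hj : 2 ^ (n.toNat - i) ≤ j) :
      PresRel n (MvPolynomial.X (Gen.v i hi j) -
        MvPolynomial.X (Gen.tauPow hn) * MvPolynomial.X (Gen.v i hi (j - 2 ^ (n.toNat - i))))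

/-- The commutative `𝔽₂`-algebra with the above generators and relations. -/
abbrev Presented (n : ℕ∞) : Type := Free n ⧸ Ideal.span {p : Free n | PresRel n p}

/-- The image of a generator in the presented algebra. -/
def gen (n : ℕ∞) (g : Gen n) : Presented n := Ideal.Quotient.mk _ (MvPolynomial.X g)

end RealMotivic

end

noncomputable section

namespace RealMotivic

/-! ### A basis of `Γ` over `𝕄₂` -/

/-! Everything takes place in the cobar complex with its explicit `𝔽₂`-basis `ρ^p τ^a
[e_{S_1}|⋯|e_{S_k}]`, where `e_S` is a square-free monomial in the `τ_i`. The source of the answer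
is the formula `η_R(τ^(2^i)) = τ^(2^i) + ρ^(2^(i+1)-1) τ_i`, which follows by repeated squaring from
`τ_i² = ρ τ_{i+1}`. For `a = 2^i (2j+1)` it makes `d(τ^a)` equal to `ρ^(2^(i+1)-1)` times a cocycle
with leading term `τ^(2^(i+1) j) [τ_i]`. This cocycle is `vCochain n i j`, and the torsion relation
is immediate. Multiplication by `ρ` is injective on the complex (`of0_rho_pow_cancel`), so the other
relations can be checked after multiplication by a power of `ρ`, where the Leibniz rule applies to
the powers of `τ` (`vCochain_comm`, `vCochain_mul`, `vCochain_periodic`).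

The additive structure comes from one algebraic Morse matching that does the work of all pages of
the `ρ`-Bockstein spectral sequence. Modulo `ρ` the words form the cobar complex of an exterior Hopf
algebra on primitive generators, and `WordPair` cancels all of them except the nondecreasing words
`[τ_{i_1}|⋯|τ_{i_k}]`, which stand for the monomials in the `v_i`. The Bockstein differentials then
match `ρ^p τ^(2^i (2j+1)) [τ_l]` with `ρ^(p+2^(i+1)-1) τ^(2^(i+1) j) [τ_i|τ_l]` when `i` is at most
every index in `l`. Leading terms are taken first with respect to `2a` plus the number of factors
`τ_i`. The differential preserves the sum of this number and `p`, so leading means lowest in `ρ`. By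
`homology_basis_of_matching`, cocycles that lift the unmatched elements form a basis of the
cohomology (`cobar_homology_basis`).

In the presented algebra the relations reduce every element to a combination of normal forms with
the same index set `Crit n` (`span_nf`). The comparison map sends these normal forms to the basis of
`Ext`, so a spanning set goes bijectively to a basis, and the map is an isomorphism. -/

/-- The monomial `∏_{i ∈ S} τ_i`. -/
def eG (n : ℕ∞) (S : Finset ℕ) : Gamma n := ∏ i ∈ S, tauG n i

@[simp] theorem eG_empty (n : ℕ∞) : eG n ∅ = 1 := Finset.prod_empty

@[simp] theorem eG_singleton (n : ℕ∞) (i : ℕ) : eG n {i} = tauG n i := Finset.prod_singleton _ _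

/-- The finite sets that index nonzero monomials. -/
abbrev Idx (n : ℕ∞) : Type := {S : Finset ℕ // ∀ i ∈ S, (i : ℕ∞) ≤ n}

theorem eG_eq_zero {n : ℕ∞} {S : Finset ℕ} (h : ¬ ∀ i ∈ S, (i : ℕ∞) ≤ n) : eG n S = 0 := by
  push Not at h
  obtain ⟨i, hi, hin⟩ := h
  exact Finset.prod_eq_zero hi (tauG_eq_zero n i hin)

theorem etaL_mul_eq_smul (n : ℕ∞) (a : M2) (g : Gamma n) : etaL n a * g = a • g := by
  rw [Algebra.smul_def]; rfl

/-- This is binary addition with carry: if `i` already occurs in `S`, then `τ_i² = ρ τ_{i+1}`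
replaces the product by a multiple of `τ_{i+1}` times a monomial with fewer factors, so induction on
the number of factors terminates. -/
theorem tauG_mul_eG_mem (n : ℕ∞) (k : ℕ) : ∀ (S : Finset ℕ), S.card = k → ∀ i : ℕ,
    tauG n i * eG n S ∈ Submodule.span M2 (Set.range (eG n)) := by
  induction k with
  | zero =>
    intro S hS i
    rw [Finset.card_eq_zero.1 hS, eG_empty, mul_one, ← eG_singleton]
    exact Submodule.subset_span ⟨_, rfl⟩
  | succ k ih =>
    intro S hS i
    by_cases hi : i ∈ S
    · have h1 : eG n S = tauG n i * eG n (S.erase i) :=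
        (Finset.mul_prod_erase S (tauG n) hi).symm
      rw [h1, ← mul_assoc, ← pow_two, tauG_sq, mul_assoc, etaL_mul_eq_smul]
      exact Submodule.smul_mem _ _
        (ih _ (by rw [Finset.card_erase_of_mem hi, hS, Nat.add_sub_cancel]) _)
    · have h1 : tauG n i * eG n S = eG n (insert i S) := (Finset.prod_insert hi).symm
      rw [h1]
      exact Submodule.subset_span ⟨_, rfl⟩

theorem span_eG (n : ℕ∞) : Submodule.span M2 (Set.range (eG n)) = ⊤ := by
  rw [eq_top_iff]
  rintro g -
  obtain ⟨p, rfl⟩ : ∃ p, gammaMk n p = g := Ideal.Quotient.mk_surjective g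
  induction p using MvPolynomial.induction_on with
  | C a =>
    have : gammaMk n (MvPolynomial.C a) = a • eG n ∅ := by
      rw [← etaL_mul_eq_smul, eG_empty, mul_one]; rfl
    rw [this]
    exact Submodule.smul_mem _ _ (Submodule.subset_span ⟨_, rfl⟩)
  | add p q hp hq => rw [map_add]; exact Submodule.add_mem _ hp hq
  | mul_X p i hp =>
    rw [map_mul, mul_comm]
    change tauG n i * _ ∈ _
    generalize gammaMk n p = g at hp ⊢
    induction hp using Submodule.span_induction with
    | mem x hx => obtain ⟨S, rfl⟩ := hx; exact tauG_mul_eG_mem n _ S rfl i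
    | zero => rw [mul_zero]; exact Submodule.zero_mem _
    | add x y _ _ hx hy => rw [mul_add]; exact Submodule.add_mem _ hx hy
    | smul a x _ hx => rw [mul_smul_comm]; exact Submodule.smul_mem _ _ hx

/-- The monomial `∏_{i ∈ S} τ_i` maps to a scalar multiple of `x ^ binVal S`. -/
def binVal (S : Finset ℕ) : ℕ := ∑ i ∈ S, 2 ^ i

theorem binVal_injective : Function.Injective binVal := by
  intro S T h
  exact Finset.equivBitIndices.symm.injective (by simpa [binVal, Finset.equivBitIndices] using h)

theorem binVal_lt (S : Finset ℕ) (k : ℕ) (h : ∀ i ∈ S, i < k) : binVal S < 2 ^ k := by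
  calc binVal S ≤ ∑ i ∈ Finset.range k, 2 ^ i :=
        Finset.sum_le_sum_of_subset (fun i hi => Finset.mem_range.2 (h i hi))
    _ < 2 ^ k := by rw [Nat.geomSum_eq le_rfl]; simp

theorem rho_ne_zero : rho ≠ 0 := MvPolynomial.X_ne_zero _

/-- The unit by which the generator `τ_i` is scaled in `Frac(𝕄₂)[x]`. -/
def rhoUnit : FractionRing M2 := algebraMap M2 (FractionRing M2) rho

theorem rhoUnit_ne_zero : rhoUnit ≠ 0 := by
  unfold rhoUnit
  rw [Ne, FaithfulSMul.algebraMap_eq_zero_iff]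
  exact rho_ne_zero

/-- The map `𝕄₂[τ_0, τ_1, …] → Frac(𝕄₂)[x]`, `τ_i ↦ ρ ^ (1 - 2 ^ i) x ^ (2 ^ i)`. -/
def toFracPoly : MvPolynomial ℕ M2 →+* Polynomial (FractionRing M2) :=
  MvPolynomial.eval₂Hom (Polynomial.C.comp (algebraMap M2 (FractionRing M2)))
    fun i => Polynomial.C (rhoUnit * (rhoUnit ^ 2 ^ i)⁻¹) * Polynomial.X ^ 2 ^ i

/-- The scaling by powers of `ρ` kills the relations `τ_i² = ρ τ_{i+1}` exactly, while a generator
that is set to zero only becomes divisible by `X ^ 2 ^ i`. Coefficients below degree `2 ^ k` are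
therefore well defined on `Γ`. -/
theorem toFracPoly_mem (n : ℕ∞) (k : ℕ) (hk : ∀ i : ℕ, n < i → k ≤ i) (p : MvPolynomial ℕ M2)
    (hp : p ∈ Ideal.span (gammaRel n)) : Polynomial.X ^ 2 ^ k ∣ toFracPoly p := by
  rw [← Ideal.mem_span_singleton]
  suffices h : Ideal.span (gammaRel n) ≤
      (Ideal.span {(Polynomial.X : Polynomial (FractionRing M2)) ^ 2 ^ k}).comap toFracPoly from h hp
  rw [Ideal.span_le]
  rintro q (⟨i, rfl⟩ | ⟨i, hi, rfl⟩)
  · have : toFracPoly (MvPolynomial.X i ^ 2 - MvPolynomial.C rho * MvPolynomial.X (i + 1)) = 0 := by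
      have h0 := rhoUnit_ne_zero
      simp only [toFracPoly, map_sub, map_pow, map_mul, MvPolynomial.coe_eval₂Hom,
        MvPolynomial.eval₂_X, MvPolynomial.eval₂_C, RingHom.comp_apply]
      change _ - Polynomial.C rhoUnit * _ = 0
      rw [← Polynomial.C_mul, mul_pow, ← pow_mul, ← pow_succ, ← mul_assoc, ← sub_mul]
      have : (rhoUnit * (rhoUnit ^ 2 ^ i)⁻¹) ^ 2 -
          rhoUnit * (rhoUnit * (rhoUnit ^ 2 ^ (i + 1))⁻¹) = 0 := by
        rw [pow_succ 2 i, pow_mul]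
        field_simp
        ring
      rw [← Polynomial.C_mul, ← Polynomial.C_pow, ← Polynomial.C_mul, ← Polynomial.C_sub, this,
        map_zero, zero_mul]
    rw [SetLike.mem_coe, Ideal.mem_comap, this]
    exact Ideal.zero_mem _
  · rw [SetLike.mem_coe, Ideal.mem_comap, Ideal.mem_span_singleton]
    simp only [toFracPoly, MvPolynomial.coe_eval₂Hom, MvPolynomial.eval₂_X]
    exact Dvd.dvd.mul_left (pow_dvd_pow _ (Nat.pow_le_pow_right two_pos (hk i hi))) _

/-- Each `e_T` maps to a nonzero constant times `X ^ binVal T`, and binary expansions are unique, so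
a single coefficient isolates `c S`. -/
theorem linearIndependent_eG (n : ℕ∞) :
    LinearIndependent M2 (fun S : Idx n => eG n S.1) := by
  rw [linearIndependent_iff']
  intro s c hc S hS
  classical
  -- This `k` exceeds every element of `S`, so `binVal S < 2 ^ k`, yet no generator that is set to
  -- zero has an index below `k`.
  set k := S.1.sup id + 1 with hkdef
  have hkS : ∀ i ∈ S.1, i < k := fun i hi => Nat.lt_succ_of_le (Finset.le_sup (f := id) hi)
  have hk : ∀ i : ℕ, n < i → k ≤ i := by
    intro i hi
    refine Nat.succ_le_of_lt ((Finset.sup_lt_iff ?_).2 fun j hj => ?_)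
    · by_contra h
      have : i = 0 := by simpa using h
      rw [this] at hi
      simp at hi
    · exact_mod_cast lt_of_le_of_lt (S.2 j hj) hi
  have h0 : gammaMk n (∑ T ∈ s, MvPolynomial.C (c T) * ∏ i ∈ T.1, MvPolynomial.X i) = 0 := by
    rw [map_sum, ← hc]
    refine Finset.sum_congr rfl fun T _ => ?_
    rw [map_mul, map_prod, ← etaL_mul_eq_smul]
    rfl
  have h1 := toFracPoly_mem n k hk _ (Ideal.Quotient.eq_zero_iff_mem.1 h0)
  have h2 := (Polynomial.X_pow_dvd_iff.1 h1) (binVal S.1) (binVal_lt _ _ hkS)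
  have h3 : ∀ T : Idx n, toFracPoly (MvPolynomial.C (c T) * ∏ i ∈ T.1, MvPolynomial.X i) =
      Polynomial.C (algebraMap M2 (FractionRing M2) (c T) *
        ∏ i ∈ T.1, (rhoUnit * (rhoUnit ^ 2 ^ i)⁻¹)) * Polynomial.X ^ binVal T.1 := by
    intro T
    simp only [toFracPoly, map_mul, map_prod, MvPolynomial.coe_eval₂Hom, MvPolynomial.eval₂_X,
      MvPolynomial.eval₂_C, RingHom.comp_apply, binVal]
    rw [Finset.prod_mul_distrib, Finset.prod_pow_eq_pow_sum, mul_assoc]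
  rw [map_sum, Polynomial.finsetSum_coeff, Finset.sum_eq_single S] at h2
  · rw [h3, Polynomial.coeff_C_mul, Polynomial.coeff_X_pow, if_pos rfl, mul_one] at h2
    rcases mul_eq_zero.1 h2 with h | h
    · exact (FaithfulSMul.algebraMap_eq_zero_iff M2 (FractionRing M2)).1 h
    · exact absurd h (Finset.prod_ne_zero_iff.2 fun i _ =>
        mul_ne_zero rhoUnit_ne_zero (inv_ne_zero (pow_ne_zero _ rhoUnit_ne_zero)))
  · intro T _ hT
    rw [h3, Polynomial.coeff_C_mul, Polynomial.coeff_X_pow, if_neg, mul_zero]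
    exact fun h => hT (Subtype.ext (binVal_injective h).symm)
  · exact fun h => absurd hS h

/-- The basis of `Γ` over `𝕄₂` that consists of the square-free monomials in the `τ_i`. -/
def basisGamma (n : ℕ∞) : Module.Basis (Idx n) M2 (Gamma n) :=
  Module.Basis.mk (linearIndependent_eG n) (by
    rw [← span_eG n, Submodule.span_le]
    rintro _ ⟨S, rfl⟩
    by_cases h : ∀ i ∈ S, (i : ℕ∞) ≤ n
    · exact Submodule.subset_span ⟨⟨S, h⟩, rfl⟩
    · rw [eG_eq_zero h]
      exact Submodule.zero_mem _)

theorem basisGamma_apply (n : ℕ∞) (S : Idx n) : basisGamma n S = eG n S.1 := by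
  simp [basisGamma]

/-! ### A basis of the cobar complex over `𝔽₂` -/

/-- The cochain `[e_{S_1}|⋯|e_{S_k}]`. -/
def word (n : ℕ∞) (w : List (Finset ℕ)) : Cobar n := (w.map fun S => of1 n (eG n S)).prod

@[simp] theorem word_nil (n : ℕ∞) : word n [] = 1 := rfl

@[simp] theorem word_cons (n : ℕ∞) (S : Finset ℕ) (w : List (Finset ℕ)) :
    word n (S :: w) = of1 n (eG n S) * word n w := List.prod_cons

/-- The words in letters that index nonzero monomials. -/
def GoodWord (n : ℕ∞) (w : List (Finset ℕ)) : Prop := ∀ S ∈ w, ∀ i ∈ S, (i : ℕ∞) ≤ n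

theorem word_eq_zero {n : ℕ∞} {w : List (Finset ℕ)} (h : ¬ GoodWord n w) : word n w = 0 := by
  induction w with
  | nil => exact absurd (by simp [GoodWord]) h
  | cons S w ih =>
    rw [word_cons]
    by_cases hS : ∀ i ∈ S, (i : ℕ∞) ≤ n
    · rw [ih, mul_zero]
      intro hw
      apply h
      intro T hT
      rcases List.mem_cons.1 hT with rfl | hT
      · exact hS
      · exact hw T hT
    · rw [eG_eq_zero hS, map_zero, zero_mul]

theorem ofPair_eq (n : ℕ∞) (p : M2 × Gamma n) : ofPair n p = of0 n p.1 + of1 n p.2 := by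
  rw [← ofPair_inl, ← ofPair_inr, ← map_add, Prod.mk_add_mk, add_zero, zero_add]

theorem of1_smul (n : ℕ∞) (a : M2) (g : Gamma n) : of1 n (a • g) = of0 n a * of1 n g := by
  rw [of0_mul_of1, etaL_mul_eq_smul]

/-- Induction over the ring structure of the cobar complex. -/
theorem cobar_induction (n : ℕ∞) {P : Cobar n → Prop} (h0 : ∀ a, P (of0 n a))
    (h1 : ∀ g, P (of1 n g)) (hadd : ∀ x y, P x → P y → P (x + y))
    (hmul : ∀ x y, P x → P y → P (x * y)) (x : Cobar n) : P x := by
  obtain ⟨y, rfl⟩ := RingQuot.mkAlgHom_surjective (ZMod 2) (CobarRel n) x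
  induction y using TensorAlgebra.induction with
  | algebraMap r =>
    have : RingQuot.mkAlgHom (ZMod 2) (CobarRel n) (algebraMap _ _ r) = of0 n (r • 1) := by
      rw [AlgHom.commutes, map_smul, of0_one, Algebra.algebraMap_eq_smul_one]
    rw [this]
    exact h0 _
  | ι p =>
    change P (ofPair n p)
    rw [ofPair_eq]
    exact hadd _ _ (h0 _) (h1 _)
  | mul x y hx hy => rw [map_mul]; exact hmul _ _ hx hy
  | add x y hx hy => rw [map_add]; exact hadd _ _ hx hy

theorem span_of0_mul_word (n : ℕ∞) (x : Cobar n) :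
    x ∈ Submodule.span (ZMod 2) {y | ∃ a w, y = of0 n a * word n w} := by
  set M := Submodule.span (ZMod 2) {y | ∃ a w, y = of0 n a * word n w} with hM
  -- Stability of the span under left multiplication is multiplicative in `x`, so it can be checked
  -- on generators; applied to `1` it gives the claim.
  have key : ∀ m ∈ M, x * m ∈ M := by
    induction x using cobar_induction with
    | h0 a =>
      intro m hm
      induction hm using Submodule.span_induction with
      | mem m hm =>
        obtain ⟨b, w, rfl⟩ := hm
        rw [← mul_assoc, of0_mul]
        exact Submodule.subset_span ⟨_, _, rfl⟩
      | zero => rw [mul_zero]; exact zero_mem _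
      | add x y _ _ hx hy => rw [mul_add]; exact add_mem hx hy
      | smul c x _ hx => rw [mul_smul_comm]; exact Submodule.smul_mem _ _ hx
    | h1 g =>
      intro m hm
      induction hm using Submodule.span_induction with
      | mem m hm =>
        obtain ⟨b, w, rfl⟩ := hm
        rw [← mul_assoc, of1_mul_of0]
        have hg : etaR n b * g ∈ Submodule.span M2 (Set.range (eG n)) := by
          rw [span_eG]; trivial
        generalize etaR n b * g = g' at hg
        -- The extra coefficient `c` absorbs the scalars from `𝕄₂`, over which `M` is not known to
        -- be a submodule.
        suffices h : ∀ c : M2, of0 n c * of1 n g' * word n w ∈ M by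
          simpa only [of0_one, one_mul] using h 1
        induction hg using Submodule.span_induction with
        | mem x hx =>
          obtain ⟨S, rfl⟩ := hx
          intro c
          rw [mul_assoc, ← word_cons]
          exact Submodule.subset_span ⟨_, _, rfl⟩
        | zero => simp
        | add x y _ _ hx hy =>
          intro c
          rw [map_add, mul_add, add_mul]
          exact add_mem (hx c) (hy c)
        | smul a x _ hx =>
          intro c
          rw [of1_smul, ← mul_assoc (of0 n c), of0_mul]
          exact hx _
      | zero => rw [mul_zero]; exact zero_mem _
      | add x y _ _ hx hy => rw [mul_add]; exact add_mem hx hy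
      | smul c x _ hx => rw [mul_smul_comm]; exact Submodule.smul_mem _ _ hx
    | hadd x y hx hy => intro m hm; rw [add_mul]; exact add_mem (hx m hm) (hy m hm)
    | hmul x y hx hy => intro m hm; rw [mul_assoc]; exact hx _ (hy m hm)
  have h1 : (1 : Cobar n) ∈ M :=
    Submodule.subset_span ⟨1, [], by rw [of0_one, word_nil, mul_one]⟩
  simpa using key 1 h1

/-- The free `𝕄₂`-module on words. -/
abbrev WordModule (n : ℕ∞) : Type := List (Idx n) →₀ M2

/-- The action of `𝕄₂` on `WordModule n`. -/
def wordAct0 (n : ℕ∞) : M2 →ₗ[ZMod 2] WordModule n →ₗ[ZMod 2] WordModule n :=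
  (Algebra.lsmul (ZMod 2) (ZMod 2) (WordModule n)).toLinearMap

theorem wordAct0_apply (n : ℕ∞) (a : M2) (x : WordModule n) : wordAct0 n a x = a • x := rfl

/-- The map `∑_S c_S e_S ↦ ∑_S c_S (S w)`. -/
def prependGamma (n : ℕ∞) (w : List (Idx n)) : Gamma n →ₗ[M2] WordModule n :=
  Finsupp.lmapDomain M2 M2 (· :: w) ∘ₗ (basisGamma n).repr.toLinearMap

/-- `g` acts on words by `g · (a w) = ∑_S c_S (S w)`, where `g η_R(a) = ∑_S c_S e_S`. -/
def wordAct1 (n : ℕ∞) : Gamma n →ₗ[ZMod 2] WordModule n →ₗ[ZMod 2] WordModule n :=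
  LinearMap.mk₂ (ZMod 2)
    (fun g x => x.sum fun w a => prependGamma n w (etaR n a * g))
    (fun g g' x => by
      simp only [mul_add, map_add]
      exact Finsupp.sum_add)
    (fun c g x => by
      rw [Finsupp.smul_sum]
      refine Finsupp.sum_congr fun w _ => ?_
      rw [mul_smul_comm, LinearMap.map_smul_of_tower])
    (fun g x y => by
      classical
      refine Finsupp.sum_add_index' (fun w => ?_) fun w a b => ?_
      · simp
      · rw [map_add, add_mul, map_add])
    (fun c g x => by
      rw [Finsupp.sum_smul_index', Finsupp.smul_sum]
      · refine Finsupp.sum_congr fun w _ => ?_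
        rw [map_smul, smul_mul_assoc, LinearMap.map_smul_of_tower]
      · simp)

theorem wordAct1_single (n : ℕ∞) (g : Gamma n) (w : List (Idx n)) (a : M2) :
    wordAct1 n g (Finsupp.single w a) = prependGamma n w (etaR n a * g) := by
  refine (Finsupp.sum_single_index (h := fun w a => prependGamma n w (etaR n a * g)) ?_ :)
  rw [map_zero, zero_mul, map_zero]

/-- The action of the cobar complex on `WordModule n`. -/
def wordAct (n : ℕ∞) : Cobar n →ₐ[ZMod 2] Module.End (ZMod 2) (WordModule n) :=
  RingQuot.liftAlgHom (ZMod 2)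
    ⟨TensorAlgebra.lift (ZMod 2) (LinearMap.coprod (wordAct0 n) (wordAct1 n)), by
      intro x y h
      cases h with
      | one =>
        ext x
        simp [wordAct0_apply]
      | mul a b =>
        refine LinearMap.ext fun x => ?_
        simp [wordAct0_apply, mul_smul]
      | left a g =>
        refine Finsupp.lhom_ext fun w b => ?_
        simp only [map_mul, TensorAlgebra.lift_ι_apply, LinearMap.coprod_apply, map_zero, add_zero,
          zero_add, Module.End.mul_apply, wordAct1_single, wordAct0_apply]
        rw [mul_left_comm, etaL_mul_eq_smul, map_smul]
      | right g a =>
        refine Finsupp.lhom_ext fun w b => ?_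
        simp only [map_mul, TensorAlgebra.lift_ι_apply, LinearMap.coprod_apply, map_zero, add_zero,
          zero_add, Module.End.mul_apply, wordAct1_single, wordAct0_apply, Finsupp.smul_single,
          smul_eq_mul]
        rw [← mul_assoc, mul_comm (etaR n a)]⟩

theorem wordAct_of0 (n : ℕ∞) (a : M2) (x : WordModule n) : wordAct n (of0 n a) x = a • x := by
  simp [wordAct, of0, ofPair, wordAct0_apply]

theorem wordAct_of1 (n : ℕ∞) (g : Gamma n) (x : WordModule n) :
    wordAct n (of1 n g) x = wordAct1 n g x := by
  simp [wordAct, of1, ofPair]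

/-- The coordinates of a cochain with respect to words. -/
def toWord (n : ℕ∞) : Cobar n →ₗ[ZMod 2] WordModule n :=
  LinearMap.applyₗ (Finsupp.single [] 1) ∘ₗ (wordAct n).toLinearMap

theorem toWord_apply (n : ℕ∞) (x : Cobar n) :
    toWord n x = wordAct n x (Finsupp.single [] 1) := rfl

theorem toWord_of0_mul (n : ℕ∞) (a : M2) (x : Cobar n) :
    toWord n (of0 n a * x) = a • toWord n x := by
  rw [toWord_apply, map_mul, Module.End.mul_apply, wordAct_of0, toWord_apply]

theorem toWord_word (n : ℕ∞) (w : List (Idx n)) :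
    toWord n (word n (w.map Subtype.val)) = Finsupp.single w 1 := by
  induction w with
  | nil => rw [toWord_apply, List.map_nil, word_nil, map_one, Module.End.one_apply]
  | cons S w ih =>
    rw [toWord_apply] at ih ⊢
    rw [List.map_cons, word_cons, map_mul, Module.End.mul_apply, ih, wordAct_of1, wordAct1_single,
      map_one, one_mul, ← basisGamma_apply, prependGamma, LinearMap.comp_apply,
      LinearEquiv.coe_coe, Module.Basis.repr_self, Finsupp.lmapDomain_apply,
      Finsupp.mapDomain_single]

theorem GoodWord.exists_map {n : ℕ∞} {w : List (Finset ℕ)} (h : GoodWord n w) :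
    ∃ w' : List (Idx n), w'.map Subtype.val = w := by
  induction w with
  | nil => exact ⟨[], rfl⟩
  | cons S w ih =>
    obtain ⟨w', hw⟩ := ih fun T hT => h T (List.mem_cons_of_mem _ hT)
    exact ⟨⟨S, h S List.mem_cons_self⟩ :: w', by rw [List.map_cons, hw]⟩

/-- Reading coordinates back as cochains is a left inverse, which only has to be checked on the
spanning cochains `a [w]`. Hence there are no hidden relations among words. -/
theorem toWord_injective (n : ℕ∞) : Function.Injective (toWord n) := by
  let back : WordModule n →ₗ[ZMod 2] Cobar n :=
    Finsupp.lsum (ZMod 2) fun w => LinearMap.mulRight (ZMod 2) (word n (w.map Subtype.val)) ∘ₗ of0 n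
  refine Function.LeftInverse.injective (g := back) fun x => ?_
  have hx := span_of0_mul_word n x
  induction hx using Submodule.span_induction with
  | mem x hx =>
    obtain ⟨a, w, rfl⟩ := hx
    by_cases hw : GoodWord n w
    · obtain ⟨w', rfl⟩ := hw.exists_map
      rw [toWord_of0_mul, toWord_word, Finsupp.smul_single, smul_eq_mul, mul_one]
      simp [back]
    · rw [word_eq_zero hw, mul_zero, map_zero, map_zero]
  | zero => rw [map_zero, map_zero]
  | add x y _ _ hx hy => rw [map_add, map_add, hx, hy]
  | smul c x _ hx => rw [map_smul, map_smul, hx]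

/-! ### Centrality and cancellation of `ρ` -/

theorem of0_rho_comm (n : ℕ∞) (x : Cobar n) : of0 n rho * x = x * of0 n rho := by
  induction x using cobar_induction with
  | h0 a => rw [of0_mul, of0_mul, mul_comm]
  | h1 g => rw [of0_mul_of1, of1_mul_of0, etaR_rho]
  | hadd x y hx hy => rw [mul_add, add_mul, hx, hy]
  | hmul x y hx hy => rw [← mul_assoc, hx, mul_assoc, hy, mul_assoc]

theorem of0_pow (n : ℕ∞) (a : M2) (k : ℕ) : of0 n (a ^ k) = of0 n a ^ k := by
  induction k with
  | zero => rw [pow_zero, pow_zero, of0_one]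
  | succ k ih => rw [pow_succ, pow_succ, ← ih, of0_mul]

theorem of0_rho_pow_comm (n : ℕ∞) (k : ℕ) (x : Cobar n) :
    of0 n (rho ^ k) * x = x * of0 n (rho ^ k) := by
  rw [of0_pow]
  exact ((show Commute (of0 n rho) x from of0_rho_comm n x).pow_left k).eq

/-- In word coordinates `ρ` acts coefficientwise on a free module over the domain `𝕄₂`. This is what
allows division of a differential by a power of `ρ`. -/
theorem of0_rho_pow_cancel (n : ℕ∞) (k : ℕ) {x y : Cobar n}
    (h : of0 n (rho ^ k) * x = of0 n (rho ^ k) * y) : x = y := by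
  apply toWord_injective
  have := congrArg (toWord n) h
  rw [toWord_of0_mul, toWord_of0_mul] at this
  ext1 w
  have hw := DFunLike.congr_fun this w
  rw [Finsupp.smul_apply, Finsupp.smul_apply, smul_eq_mul, smul_eq_mul] at hw
  exact mul_left_cancel₀ (pow_ne_zero k rho_ne_zero) hw

/-- The index set `(p, a, w)` of the cochains `ρ ^ p τ ^ a [w]`. -/
abbrev CobarIdx : Type := ℕ × ℕ × List (Finset ℕ)

/-- The cochain `ρ ^ p τ ^ a [w]`. -/
def cobarMon (n : ℕ∞) (β : CobarIdx) : Cobar n :=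
  of0 n (rho ^ β.1 * tau ^ β.2.1) * word n β.2.2

/-- The exponent of the monomial `ρ ^ p τ ^ a`. -/
def ptExp (p a : ℕ) : PtGen →₀ ℕ := Finsupp.single PtGen.rho p + Finsupp.single PtGen.tau a

theorem rho_pow_mul_tau_pow (p a : ℕ) :
    rho ^ p * tau ^ a = MvPolynomial.monomial (ptExp p a) 1 := by
  rw [rho, tau, MvPolynomial.X_pow_eq_monomial, MvPolynomial.X_pow_eq_monomial,
    MvPolynomial.monomial_mul, mul_one, ptExp]

theorem ptExp_inj {p a p' a' : ℕ} : ptExp p a = ptExp p' a' ↔ p = p' ∧ a = a' := by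
  classical
  constructor
  · intro h
    have h1 := DFunLike.congr_fun h PtGen.rho
    have h2 := DFunLike.congr_fun h PtGen.tau
    simpa [ptExp, Finsupp.single_apply] using And.intro h1 h2
  · rintro ⟨rfl, rfl⟩
    rfl

theorem exists_ptExp (m : PtGen →₀ ℕ) : m = ptExp (m PtGen.rho) (m PtGen.tau) := by
  classical
  ext (_ | _) <;> simp [ptExp]

theorem mem_span_cobarMon (n : ℕ∞) (x : Cobar n) :
    x ∈ Submodule.span (ZMod 2) (Set.range (cobarMon n)) := by
  have hx := span_of0_mul_word n x
  induction hx using Submodule.span_induction with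
  | mem x hx =>
    obtain ⟨a, w, rfl⟩ := hx
    induction a using MvPolynomial.induction_on' with
    | monomial m c =>
      have : (MvPolynomial.monomial m c : M2) =
          c • (rho ^ m PtGen.rho * tau ^ m PtGen.tau) := by
        rw [rho_pow_mul_tau_pow, ← exists_ptExp, MvPolynomial.smul_monomial, smul_eq_mul, mul_one]
      rw [this, map_smul, smul_mul_assoc]
      exact Submodule.smul_mem _ _ (Submodule.subset_span ⟨(_, _, w), rfl⟩)
    | add p q hp hq => rw [map_add, add_mul]; exact add_mem hp hq
  | zero => exact zero_mem _
  | add x y _ _ hx hy => exact add_mem hx hy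
  | smul c x _ hx => exact Submodule.smul_mem _ _ hx

/-- The indices of the nonzero cochains `ρ ^ p τ ^ a [w]`. -/
def GoodIdx (n : ℕ∞) (β : CobarIdx) : Prop := GoodWord n β.2.2

/-- The functional reads off the coefficient of `ρ^p τ^a` at one word. Independence of the basis is
used in this dual form in the Morse argument. -/
theorem exists_coord (n : ℕ∞) (β : CobarIdx) (hβ : GoodIdx n β) :
    ∃ f : Cobar n →ₗ[ZMod 2] ZMod 2, f (cobarMon n β) = 1 ∧
      ∀ β', β' ≠ β → f (cobarMon n β') = 0 := by
  classical
  obtain ⟨p, a, w⟩ := β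
  obtain ⟨w, rfl⟩ := GoodWord.exists_map hβ
  refine ⟨MvPolynomial.lcoeff (ZMod 2) (ptExp p a) ∘ₗ
    (Finsupp.lapply w : WordModule n →ₗ[M2] M2).restrictScalars (ZMod 2) ∘ₗ toWord n, ?_, ?_⟩
  · simp only [cobarMon, LinearMap.comp_apply, toWord_of0_mul, toWord_word,
      LinearMap.restrictScalars_apply, Finsupp.lapply_apply, Finsupp.smul_apply,
      Finsupp.single_eq_same, smul_eq_mul, mul_one, rho_pow_mul_tau_pow, MvPolynomial.lcoeff_apply,
      MvPolynomial.coeff_monomial, if_true]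
  · rintro ⟨p', a', w'⟩ hne
    by_cases hw : GoodWord n w'
    · obtain ⟨w', rfl⟩ := hw.exists_map
      simp only [cobarMon, LinearMap.comp_apply, toWord_of0_mul, toWord_word,
        LinearMap.restrictScalars_apply, Finsupp.lapply_apply, Finsupp.smul_apply, smul_eq_mul,
        rho_pow_mul_tau_pow, MvPolynomial.lcoeff_apply, Finsupp.single_apply]
      split_ifs with h
      · rw [mul_one, MvPolynomial.coeff_monomial, if_neg]
        rw [ptExp_inj]
        rintro ⟨rfl, rfl⟩
        exact hne (by rw [h])
      · rw [mul_zero, MvPolynomial.coeff_zero]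
    · simp only [cobarMon, word_eq_zero hw, mul_zero, map_zero]

/-! ### The differential in terms of words -/

theorem comul_eG (n : ℕ∞) (S : Finset ℕ) :
    comul n (eG n S) = ∑ A ∈ S.powerset, inFst n (eG n A) * inSnd n (eG n (S \ A)) := by
  classical
  simp only [eG, map_prod, comul_tauG]
  rw [Finset.prod_add]

theorem ofTwo_comul_eG (n : ℕ∞) (S : Finset ℕ) :
    ofTwo n (comul n (eG n S)) =
      ∑ A ∈ S.powerset, of1 n (eG n A) * of1 n (eG n (S \ A)) := by
  rw [comul_eG, map_sum]
  exact Finset.sum_congr rfl fun A _ => ofTwo_tmul n _ _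

theorem diff_of1_eG (n : ℕ∞) (S : Finset ℕ) :
    diff n (of1 n (eG n S)) = of1 n 1 * of1 n (eG n S) + of1 n (eG n S) * of1 n 1 +
      ∑ A ∈ S.powerset, of1 n (eG n A) * of1 n (eG n (S \ A)) := by
  rw [diff_of1, ofTwo_comul_eG, cobar_sub]
  abel

theorem diff_of1_one (n : ℕ∞) : diff n (of1 n 1) = of1 n 1 * of1 n 1 := by
  have h := diff_of1_eG n ∅
  rw [Finset.powerset_empty, Finset.sum_singleton, Finset.sdiff_empty, eG_empty,
    cobar_add_self, zero_add] at h
  exact h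

theorem diff_of1_tauG (n : ℕ∞) (i : ℕ) : diff n (of1 n (tauG n i)) = 0 := by
  rw [diff_of1, comul_tauG, map_add]
  have h1 := ofTwo_tmul n (tauG n i) 1
  have h2 := ofTwo_tmul n 1 (tauG n i)
  rw [map_one, mul_one] at h1
  rw [map_one, one_mul] at h2
  rw [h1, h2]
  abel

/-! ### The differential squares to zero -/

theorem diff_diff_mul (n : ℕ∞) (x y : Cobar n) (hx : diff n (diff n x) = 0)
    (hy : diff n (diff n y) = 0) : diff n (diff n (x * y)) = 0 := by
  rw [diff_mul, map_add, diff_mul, diff_mul, hx, hy, mul_zero, zero_mul, zero_add, add_zero,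
    cobar_add_self]

/-- The two surviving terms `[η_R(a)|1]` and `[1|η_L(a)]` agree in the tensor product over `𝕄₂`. -/
theorem diff_diff_of0 (n : ℕ∞) (a : M2) : diff n (diff n (of0 n a)) = 0 := by
  have h1 : diff n (of1 n (etaR n a)) = of1 n (etaR n a) * of1 n 1 := by
    have h := ofTwo_tmul n 1 (etaR n a)
    rw [map_one, one_mul] at h
    rw [diff_of1, comul_etaR, h, sub_self, zero_add]
  have h2 : diff n (of1 n (etaL n a)) = of1 n 1 * of1 n (etaL n a) := by
    have h := ofTwo_tmul n (etaL n a) 1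
    rw [map_one, mul_one] at h
    rw [diff_of1, comul_etaL, h, sub_add_cancel]
  have h3 : of1 n (etaR n a) * of1 n 1 = of1 n 1 * of1 n (etaL n a) := by
    have e1 := of1_mul_of0 n 1 a
    have e2 := of0_mul_of1 n a 1
    rw [mul_one] at e1 e2
    rw [← e1, ← e2, mul_assoc]
  rw [diff_of0, map_sub, map_sub, h1, h2, h3, sub_self]

/-- Both sides run over the ordered partitions of `S` into three parts; this is coassociativity of
the coproduct on monomials. -/
theorem sum_powerset_powerset {M : Type*} [AddCommMonoid M]
    (f : Finset ℕ → Finset ℕ → Finset ℕ → M) (S : Finset ℕ) :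
    ∑ A ∈ S.powerset, ∑ B ∈ A.powerset, f B (A \ B) (S \ A) =
      ∑ A ∈ S.powerset, ∑ B ∈ (S \ A).powerset, f A B ((S \ A) \ B) := by
  classical
  rw [Finset.sum_sigma', Finset.sum_sigma']
  refine Finset.sum_bij' (fun x _ => ⟨x.2, x.1 \ x.2⟩) (fun x _ => ⟨x.1 ∪ x.2, x.1⟩) ?_ ?_ ?_ ?_ ?_
  · rintro ⟨A, B⟩ h
    simp only [Finset.mem_sigma, Finset.mem_powerset] at h ⊢
    exact ⟨h.2.trans h.1, Finset.sdiff_subset_sdiff h.1 subset_rfl⟩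
  · rintro ⟨A, B⟩ h
    simp only [Finset.mem_sigma, Finset.mem_powerset] at h ⊢
    exact ⟨Finset.union_subset h.1 (h.2.trans Finset.sdiff_subset), Finset.subset_union_left⟩
  · rintro ⟨A, B⟩ h
    simp only [Finset.mem_sigma, Finset.mem_powerset] at h
    simp [Finset.union_sdiff_of_subset h.2]
  · rintro ⟨A, B⟩ h
    simp only [Finset.mem_sigma, Finset.mem_powerset] at h
    have : Disjoint A B := (Finset.sdiff_disjoint.mono_left h.2).symm
    simp [Finset.union_sdiff_cancel_left this]
  · rintro ⟨A, B⟩ h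
    simp only [Finset.mem_sigma, Finset.mem_powerset] at h
    have : S \ A = (S \ B) \ (A \ B) := by
      ext i
      have := @h.2 i
      simp only [Finset.mem_sdiff]
      tauto
    rw [this]

theorem diff_diff_of1_eG (n : ℕ∞) (S : Finset ℕ) : diff n (diff n (of1 n (eG n S))) = 0 := by
  set θ := of1 n 1 with hθ
  set e : Finset ℕ → Cobar n := fun A => of1 n (eG n A) with he
  have hd : ∀ A, diff n (e A) = θ * e A + e A * θ + ∑ B ∈ A.powerset, e B * e (A \ B) :=
    fun A => diff_of1_eG n A
  have hθd : diff n θ = θ * θ := diff_of1_one n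
  have hsum : diff n (∑ A ∈ S.powerset, e A * e (S \ A)) =
      θ * (∑ A ∈ S.powerset, e A * e (S \ A)) + (∑ A ∈ S.powerset, e A * e (S \ A)) * θ := by
    rw [map_sum, Finset.mul_sum, Finset.sum_mul]
    have hA : ∀ A, diff n (e A * e (S \ A)) =
        (∑ B ∈ A.powerset, e B * e (A \ B) * e (S \ A) +
          ∑ B ∈ (S \ A).powerset, e A * e B * e ((S \ A) \ B)) +
        (θ * (e A * e (S \ A)) + e A * e (S \ A) * θ) := by
      intro A
      rw [diff_mul, hd, hd]
      simp only [mul_add, add_mul, Finset.sum_mul, Finset.mul_sum, mul_assoc]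
      -- The cochain `[e_A|1|e_{S∖A}]` arises once from each of the two factors.
      have h0 := cobar_add_self n (e A * (θ * e (S \ A)))
      rw [← sub_eq_zero]
      calc _ = e A * (θ * e (S \ A)) + e A * (θ * e (S \ A)) := by abel
        _ = 0 := h0
    rw [Finset.sum_congr rfl fun A _ => hA A, Finset.sum_add_distrib, Finset.sum_add_distrib,
      sum_powerset_powerset (fun A B D => e A * e B * e D), cobar_add_self, zero_add,
      Finset.sum_add_distrib]
  change diff n (diff n (e S)) = 0
  rw [hd, map_add, hsum, map_add, diff_mul, diff_mul, hd, hθd]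
  generalize ∑ A ∈ S.powerset, e A * e (S \ A) = δ
  simp only [mul_add, add_mul, mul_assoc]
  have h2 : ∀ x : Cobar n, 2 * x = 0 := fun x => by rw [two_mul, cobar_add_self]
  abel_nf
  simp [h2]

theorem diff_diff (n : ℕ∞) (x : Cobar n) : diff n (diff n x) = 0 := by
  induction x using cobar_induction with
  | h0 a => exact diff_diff_of0 n a
  | h1 g =>
    have hg : g ∈ Submodule.span M2 (Set.range (eG n)) := by rw [span_eG]; trivial
    induction hg using Submodule.span_induction with
    | mem x hx => obtain ⟨S, rfl⟩ := hx; exact diff_diff_of1_eG n S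
    | zero => simp
    | add x y _ _ hx hy => rw [map_add, map_add, map_add, hx, hy, add_zero]
    | smul a x _ hx => rw [of1_smul]; exact diff_diff_mul n _ _ (diff_diff_of0 n a) hx
  | hadd x y hx hy => rw [map_add, map_add, hx, hy, add_zero]
  | hmul x y hx hy => exact diff_diff_mul n x y hx hy

theorem diff_of0_rho_pow (n : ℕ∞) (k : ℕ) : diff n (of0 n (rho ^ k)) = 0 := by
  rw [diff_of0, map_pow, map_pow, etaR_rho, sub_self, map_zero]

theorem diff_of0_rho_pow_mul (n : ℕ∞) (k : ℕ) (x : Cobar n) :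
    diff n (of0 n (rho ^ k) * x) = of0 n (rho ^ k) * diff n x := by
  rw [diff_mul, diff_of0_rho_pow, zero_mul, add_zero]

/-! ### The right unit on powers of `τ` -/

theorem gamma_two (n : ℕ∞) : (2 : Gamma n) = 0 := by
  have := congrArg (algebraMap (ZMod 2) (Gamma n)) (show (2 : ZMod 2) = 0 by decide)
  rwa [map_ofNat, map_zero] at this

/-- The length `2 ^ (i + 1) - 1` of the differential on `τ ^ (2 ^ i)`. -/
def rhoLen (i : ℕ) : ℕ := 2 ^ (i + 1) - 1

theorem rhoLen_add_one (i : ℕ) : rhoLen i + 1 = 2 ^ (i + 1) :=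
  Nat.sub_add_cancel Nat.one_le_two_pow

theorem rhoLen_pos (i : ℕ) : 0 < rhoLen i := by
  have := rhoLen_add_one i
  have h : 2 ^ (i + 1) = 2 * 2 ^ i := pow_succ' 2 i
  have := Nat.one_le_two_pow (n := i)
  omega

theorem rhoLen_succ (i : ℕ) : rhoLen (i + 1) = 2 * rhoLen i + 1 := by
  have h1 := rhoLen_add_one i
  have h2 := rhoLen_add_one (i + 1)
  rw [pow_succ'] at h2
  omega

theorem rhoLen_strictMono : StrictMono rhoLen :=
  strictMono_nat_of_lt_succ fun i => by rw [rhoLen_succ]; omega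

/-- Squaring is additive in characteristic `2`, and `τ_i² = ρ τ_{i+1}` turns the exponent of `ρ`
into twice itself plus one. This determines the length of every Bockstein differential. -/
theorem etaR_tau_two_pow (n : ℕ∞) (i : ℕ) :
    etaR n (tau ^ 2 ^ i) = etaL n rho ^ rhoLen i * tauG n i + etaL n tau ^ 2 ^ i := by
  induction i with
  | zero => rw [pow_zero, pow_one, pow_one, etaR_tau, add_comm]; simp [rhoLen]
  | succ i ih =>
    rw [pow_succ, pow_mul, map_pow, ih, add_sq, mul_pow, tauG_sq, gamma_two, zero_mul, zero_mul,
      add_zero, ← pow_mul, ← pow_mul, ← mul_assoc, ← pow_succ, ← pow_succ, rhoLen_succ,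
      mul_comm (rhoLen i)]

/-- The exponent of `ρ` that accompanies `e_S` in the right unit. -/
def rhoWt (S : Finset ℕ) : ℕ := ∑ i ∈ S, rhoLen i

/-- Factor `τ^a` along the binary digits of `a` and expand the product of the binomials from
`etaR_tau_two_pow`; the subset `S` records where the second unit contributes `τ_i`. -/
theorem etaR_tau_binVal (n : ℕ∞) (T : Finset ℕ) :
    etaR n (tau ^ binVal T) =
      ∑ S ∈ T.powerset, (rho ^ rhoWt S * tau ^ binVal (T \ S)) • eG n S := by
  classical
  rw [binVal, ← Finset.prod_pow_eq_pow_sum, map_prod]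
  simp only [etaR_tau_two_pow]
  rw [Finset.prod_add]
  refine Finset.sum_congr rfl fun S _ => ?_
  rw [← etaL_mul_eq_smul, map_mul, map_pow, map_pow, Finset.prod_mul_distrib,
    Finset.prod_pow_eq_pow_sum, Finset.prod_pow_eq_pow_sum, rhoWt, binVal, eG]
  ring

/-- The positions of the binary digits `1` of `a`. -/
def bits (a : ℕ) : Finset ℕ := Finset.equivBitIndices a

theorem binVal_bits (a : ℕ) : binVal (bits a) = a :=
  Finset.equivBitIndices.symm_apply_apply a

theorem bits_eq {a : ℕ} {T : Finset ℕ} (h : binVal T = a) : bits a = T :=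
  binVal_injective (by rw [binVal_bits, h])

theorem binVal_map (T : Finset ℕ) (i : ℕ) :
    binVal (T.map (addRightEmbedding i)) = 2 ^ i * binVal T := by
  rw [binVal, Finset.sum_map, binVal, Finset.mul_sum]
  exact Finset.sum_congr rfl fun k _ => by rw [addRightEmbedding_apply, pow_add, mul_comm]

theorem le_of_mem_bits {i a k : ℕ} (h : 2 ^ i ∣ a) (hk : k ∈ bits a) : i ≤ k := by
  obtain ⟨b, rfl⟩ := h
  rw [bits_eq (T := (bits b).map (addRightEmbedding i)) (by rw [binVal_map, binVal_bits])] at hk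
  obtain ⟨l, -, rfl⟩ := Finset.mem_map.1 hk
  exact Nat.le_add_left i l

theorem bits_two_pow_mul_odd (i j : ℕ) :
    bits (2 ^ i * (2 * j + 1)) = insert i (bits (2 ^ (i + 1) * j)) := by
  apply bits_eq
  have hi : i ∉ bits (2 ^ (i + 1) * j) := fun h =>
    absurd (le_of_mem_bits (Dvd.intro _ rfl) h) (by omega)
  rw [binVal, Finset.sum_insert hi]
  change _ + binVal _ = _
  rw [binVal_bits]
  ring

/-- The quotient of `η_R(τ ^ a) - η_L(τ ^ a)` by `ρ ^ rhoLen i`, for `2 ^ i ∣ a`. -/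
def etaQuot (n : ℕ∞) (i a : ℕ) : Gamma n :=
  ∑ S ∈ (bits a).powerset.erase ∅,
    (rho ^ (rhoWt S - rhoLen i) * tau ^ binVal (bits a \ S)) • eG n S

theorem rhoLen_le_rhoWt {i k : ℕ} {S : Finset ℕ} (hk : k ∈ S) (hik : i ≤ k) :
    rhoLen i ≤ rhoWt S :=
  (rhoLen_strictMono.monotone hik).trans (Finset.single_le_sum (f := rhoLen) (by simp) hk)

theorem rhoLen_le_rhoWt_of_dvd {i a : ℕ} (h : 2 ^ i ∣ a) {S : Finset ℕ}
    (hS : S ∈ (bits a).powerset.erase ∅) : rhoLen i ≤ rhoWt S := by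
  rw [Finset.mem_erase, Finset.mem_powerset] at hS
  obtain ⟨k, hk⟩ := Finset.nonempty_iff_ne_empty.2 hS.1
  exact rhoLen_le_rhoWt hk (le_of_mem_bits h (hS.2 hk))

/-- The empty subset accounts for `η_L`. Every other subset contains a digit position that is at
least `i`, and that position alone supplies the factor `ρ ^ rhoLen i`. -/
theorem etaR_sub_etaL_tau_pow (n : ℕ∞) {i a : ℕ} (h : 2 ^ i ∣ a) :
    etaR n (tau ^ a) - etaL n (tau ^ a) = etaL n (rho ^ rhoLen i) * etaQuot n i a := by
  have h0 : (∅ : Finset ℕ) ∈ (bits a).powerset := Finset.empty_mem_powerset _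
  have h1 := etaR_tau_binVal n (bits a)
  rw [binVal_bits, ← Finset.add_sum_erase _ _ h0, Finset.sdiff_empty, binVal_bits, eG_empty,
    rhoWt, Finset.sum_empty, pow_zero, one_mul, ← etaL_mul_eq_smul, mul_one] at h1
  rw [h1, add_sub_cancel_left, etaQuot, Finset.mul_sum]
  refine Finset.sum_congr rfl fun S hS => ?_
  rw [etaL_mul_eq_smul, smul_smul, ← mul_assoc, ← pow_add,
    Nat.add_sub_cancel' (rhoLen_le_rhoWt_of_dvd h hS)]

theorem diff_of0_tau_pow (n : ℕ∞) {i a : ℕ} (h : 2 ^ i ∣ a) :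
    diff n (of0 n (tau ^ a)) = of0 n (rho ^ rhoLen i) * of1 n (etaQuot n i a) := by
  rw [diff_of0, etaR_sub_etaL_tau_pow n h, of0_mul_of1]

theorem diff_of1_etaQuot (n : ℕ∞) {i a : ℕ} (h : 2 ^ i ∣ a) :
    diff n (of1 n (etaQuot n i a)) = 0 := by
  apply of0_rho_pow_cancel n (rhoLen i)
  rw [← diff_of0_rho_pow_mul, ← diff_of0_tau_pow n h, diff_diff_of0, mul_zero]

/-- Every monomial in the sum contains some `τ_k` with `k > n`. This is why the powers of
`τ^(2^(n+1))` are invariant. -/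
theorem etaQuot_eq_zero {n : ℕ∞} {i a : ℕ} (h : ∀ k ∈ bits a, n < (k : ℕ∞)) :
    etaQuot n i a = 0 := by
  refine Finset.sum_eq_zero fun S hS => ?_
  rw [Finset.mem_erase, Finset.mem_powerset] at hS
  obtain ⟨k, hk⟩ := Finset.nonempty_iff_ne_empty.2 hS.1
  rw [eG_eq_zero, smul_zero]
  exact fun h' => absurd (h' k hk) (not_le.2 (h k (hS.2 hk)))

/-! ### The matching on words -/

/-- The rank of a letter: singletons are placed directly above the other nonempty sets with the
same maximum, and the empty set is placed at the top. -/
def letterRank (S : Finset ℕ) : ℕ∞ :=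
  if S = ∅ then ⊤ else ((if S.card = 1 then 2 * S.sup id + 1 else 2 * S.sup id : ℕ) : ℕ∞)

theorem letterRank_empty : letterRank ∅ = ⊤ := if_pos rfl

theorem letterRank_lt_top {S : Finset ℕ} (h : S.Nonempty) : letterRank S < ⊤ := by
  rw [letterRank, if_neg h.ne_empty]
  exact ENat.natCast_lt_top _

theorem letterRank_singleton (i : ℕ) : letterRank {i} = ((2 * i + 1 : ℕ) : ℕ∞) := by
  simp [letterRank]

theorem sup_insert_eq {m : ℕ} {y : Finset ℕ} (hm : ∀ k ∈ y, k < m) :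
    (insert m y).sup id = m := by
  rw [Finset.sup_insert]
  exact sup_eq_left.2 (Finset.sup_le fun k hk => (hm k hk).le)

theorem card_insert_ne_one {m : ℕ} {y : Finset ℕ} (hy : y.Nonempty) (hm : ∀ k ∈ y, k < m) :
    (insert m y).card ≠ 1 := by
  rw [Finset.card_insert_of_notMem fun h => (hm m h).false]
  have := hy.card_pos
  omega

theorem letterRank_insert {m : ℕ} {y : Finset ℕ} (hy : y.Nonempty) (hm : ∀ k ∈ y, k < m) :
    letterRank (insert m y) = ((2 * m : ℕ) : ℕ∞) := by
  rw [letterRank, if_neg (Finset.insert_ne_empty _ _), if_neg (card_insert_ne_one hy hm),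
    sup_insert_eq hm]

/-- This singles out `[τ_m|e_y]` as the leading term of the coproduct of `e_{y ∪ {m}}` when `m` is
the maximum. -/
theorem letterRank_lt_singleton {m : ℕ} {A : Finset ℕ} (hA : A.Nonempty) (h : A ≠ {m})
    (hm : ∀ k ∈ A, k ≤ m) : letterRank A < letterRank {m} := by
  rw [letterRank_singleton, letterRank, if_neg hA.ne_empty, Nat.cast_lt]
  have h1 : A.sup id ≤ m := Finset.sup_le hm
  split_ifs with hc
  · obtain ⟨a, rfl⟩ := Finset.card_eq_one.1 hc
    rw [Finset.sup_singleton, id] at h1 ⊢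
    have : a ≠ m := fun h' => h (by rw [h'])
    omega
  · omega

theorem two_mul_le_letterRank_iff {i : ℕ} {y : Finset ℕ} (hy : y.Nonempty) :
    ((2 * i : ℕ) : ℕ∞) ≤ letterRank y ↔ ∃ k ∈ y, i ≤ k := by
  obtain ⟨m, hm, hm'⟩ := Finset.exists_mem_eq_sup y hy id
  rw [letterRank, if_neg hy.ne_empty, Nat.cast_le, hm', id]
  have h1 : (∃ k ∈ y, i ≤ k) ↔ i ≤ m := by
    refine ⟨?_, fun h => ⟨m, hm, h⟩⟩
    rintro ⟨k, hk, hik⟩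
    exact hik.trans ((Finset.le_sup (f := id) hk).trans hm'.le)
  rw [h1]
  split_ifs <;> omega

/-- The first letter of the word can follow the letter `{i}` in a critical prefix. -/
def HeadGE (i : ℕ) : List (Finset ℕ) → Prop
  | [] => True
  | y :: _ => ((2 * i : ℕ) : ℕ∞) ≤ letterRank y

/-- The matching between words: the second word is the leading term of the differential of the
first. -/
inductive WordPair : List (Finset ℕ) → List (Finset ℕ) → Prop
  | split (m : ℕ) (y : Finset ℕ) (r : List (Finset ℕ)) (hy : y.Nonempty) (hm : ∀ k ∈ y, k < m) :
      WordPair (insert m y :: r) ({m} :: y :: r)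
  | cons (i : ℕ) (t u : List (Finset ℕ)) (hi : HeadGE i t) (h : WordPair t u) :
      WordPair ({i} :: t) ({i} :: u)
  | empty (r : List (Finset ℕ)) (hr : ∀ s, r ≠ ∅ :: s) : WordPair (∅ :: r) (∅ :: ∅ :: r)
  | empty_empty (t u : List (Finset ℕ)) (h : WordPair (∅ :: t) (∅ :: u)) :
      WordPair (∅ :: ∅ :: ∅ :: t) (∅ :: ∅ :: ∅ :: u)

/-- A matched pair can change its first letter only from rank `2m` to rank `2m + 1`, and an even
threshold does not separate these two values. Prefixing a letter `{i}` therefore treats both members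
alike. -/
theorem WordPair.headGE_iff {t u : List (Finset ℕ)} (h : WordPair t u) (i : ℕ) :
    HeadGE i t ↔ HeadGE i u := by
  cases h with
  | split m y r hy hm =>
    simp only [HeadGE]
    rw [letterRank_insert hy hm, letterRank_singleton, Nat.cast_le, Nat.cast_le]
    omega
  | cons => exact Iff.rfl
  | empty => exact Iff.rfl
  | empty_empty => exact Iff.rfl

theorem WordPair.head_empty_iff {t u : List (Finset ℕ)} (h : WordPair t u) :
    (∃ s, t = ∅ :: s) ↔ ∃ s, u = ∅ :: s := by
  cases h <;> simp

/-- A leading run of empty letters is matched by parity, odd with even. A first letter with at least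
two elements is split at its maximum. A singleton `{m}` is passed over if the next letter can follow
it, and otherwise `w` is itself the result of a split. -/
theorem wordPair_cover (w : List (Finset ℕ)) :
    (∃ u, WordPair w u) ∨ (∃ t, WordPair t w) ∨
      ∃ l : List ℕ, l.Pairwise (· ≤ ·) ∧ w = l.map fun i => {i} := by
  induction hk : w.length using Nat.strong_induction_on generalizing w with
  | _ k ih =>
  subst hk
  rcases w with _ | ⟨x, w⟩
  · exact Or.inr (Or.inr ⟨[], List.Pairwise.nil, rfl⟩)
  rcases x.eq_empty_or_nonempty with rfl | hx
  · by_cases hw : ∃ s, w = ∅ :: s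
    · obtain ⟨s, rfl⟩ := hw
      by_cases hs : ∃ s', s = ∅ :: s'
      · obtain ⟨s', rfl⟩ := hs
        rcases ih (∅ :: s').length (by simp) (∅ :: s') rfl with ⟨u, hu⟩ | ⟨t, ht⟩ | ⟨l, -, hl⟩
        · obtain ⟨u', rfl⟩ := hu.head_empty_iff.1 ⟨_, rfl⟩
          exact Or.inl ⟨_, WordPair.empty_empty _ _ hu⟩
        · obtain ⟨t', rfl⟩ := ht.head_empty_iff.2 ⟨_, rfl⟩
          exact Or.inr (Or.inl ⟨_, WordPair.empty_empty _ _ ht⟩)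
        · rcases l with _ | ⟨i, l⟩
          · simp at hl
          · exact absurd (List.cons.inj hl).1.symm (Finset.singleton_ne_empty i)
      · exact Or.inr (Or.inl ⟨_, WordPair.empty s fun s' h => hs ⟨s', h⟩⟩)
    · exact Or.inl ⟨_, WordPair.empty w fun s h => hw ⟨s, h⟩⟩
  obtain ⟨m, hm, hm'⟩ := Finset.exists_mem_eq_sup x hx id
  have hmax : ∀ k ∈ x.erase m, k < m := fun k hk =>
    lt_of_le_of_ne ((Finset.le_sup (f := id) (Finset.mem_of_mem_erase hk)).trans hm'.le)
      (Finset.ne_of_mem_erase hk)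
  rcases (x.erase m).eq_empty_or_nonempty with he | hne
  · obtain rfl : x = {m} := by rw [← Finset.insert_erase hm, he]; rfl
    by_cases hg : HeadGE m w
    · rcases ih w.length (by simp) w rfl with ⟨u, hu⟩ | ⟨t, ht⟩ | ⟨l, hl, rfl⟩
      · exact Or.inl ⟨_, WordPair.cons m _ _ hg hu⟩
      · exact Or.inr (Or.inl ⟨_, WordPair.cons m _ _ ((ht.headGE_iff m).2 hg) ht⟩)
      · refine Or.inr (Or.inr ⟨m :: l, ?_, rfl⟩)
        rcases l with _ | ⟨i, l⟩
        · simp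
        · have : m ≤ i := by
            simp only [HeadGE, List.map_cons, letterRank_singleton, Nat.cast_le] at hg
            omega
          refine List.Pairwise.cons (fun k hk => ?_) hl
          rcases List.mem_cons.1 hk with rfl | hk
          · exact this
          · exact this.trans (List.rel_of_pairwise_cons hl hk)
    · rcases w with _ | ⟨y, r⟩
      · exact absurd trivial hg
      simp only [HeadGE] at hg
      have hy : y.Nonempty := by
        rw [Finset.nonempty_iff_ne_empty]
        rintro rfl
        exact hg (by rw [letterRank_empty]; exact le_top)
      rw [two_mul_le_letterRank_iff hy] at hg
      push Not at hg
      exact Or.inr (Or.inl ⟨_, WordPair.split m y r hy hg⟩)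
  · refine Or.inl ⟨{m} :: x.erase m :: w, ?_⟩
    have := WordPair.split m (x.erase m) w hne hmax
    rwa [Finset.insert_erase hm] at this

/-- This is inversion on the second member, with the head condition moved there by `headGE_iff`. -/
theorem WordPair.cases_right {t u : List (Finset ℕ)} (h : WordPair t u) :
    (∃ m y r, y.Nonempty ∧ (∀ k ∈ y, k < m) ∧ t = insert m y :: r ∧ u = {m} :: y :: r) ∨
    (∃ i t' u', HeadGE i u' ∧ WordPair t' u' ∧ t = {i} :: t' ∧ u = {i} :: u') ∨
    (∃ r, (∀ s, r ≠ ∅ :: s) ∧ t = ∅ :: r ∧ u = ∅ :: ∅ :: r) ∨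
    ∃ t' u', WordPair (∅ :: t') (∅ :: u') ∧ t = ∅ :: ∅ :: ∅ :: t' ∧ u = ∅ :: ∅ :: ∅ :: u' := by
  cases h with
  | split m y r hy hm => exact Or.inl ⟨m, y, r, hy, hm, rfl, rfl⟩
  | cons i t u hi h => exact Or.inr (Or.inl ⟨i, t, u, (h.headGE_iff i).1 hi, h, rfl, rfl⟩)
  | empty r hr => exact Or.inr (Or.inr (Or.inl ⟨r, hr, rfl, rfl⟩))
  | empty_empty t u h => exact Or.inr (Or.inr (Or.inr ⟨t, u, h, rfl, rfl⟩))

theorem not_headGE_cons {m : ℕ} {y : Finset ℕ} (hy : y.Nonempty) (hm : ∀ k ∈ y, k < m)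
    (r : List (Finset ℕ)) : ¬ HeadGE m (y :: r) := by
  simp only [HeadGE]
  rw [two_mul_le_letterRank_iff hy]
  rintro ⟨k, hk, hk'⟩
  exact absurd (hm k hk) (not_lt.2 hk')

/-- The head condition decides between the two rules that can produce a word starting with a
singleton, and the number of leading empty letters decides between the other two. -/
theorem WordPair.left_unique {t u : List (Finset ℕ)} (h : WordPair t u) :
    ∀ {t'}, WordPair t' u → t = t' := by
  induction h with
  | split m y r hy hm =>
    intro t' h'
    rcases h'.cases_right with ⟨m', y', r', -, -, rfl, e⟩ | ⟨i, t'', u'', hi, -, -, e⟩ |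
      ⟨r', -, -, e⟩ | ⟨t'', u'', -, -, e⟩
    · simp only [List.cons.injEq, Finset.singleton_inj] at e
      obtain ⟨rfl, rfl, rfl⟩ := e
      rfl
    · simp only [List.cons.injEq, Finset.singleton_inj] at e
      obtain ⟨rfl, rfl⟩ := e
      exact absurd hi (not_headGE_cons hy hm r)
    · simp at e
    · simp at e
  | cons i t u hi h ih =>
    intro t' h'
    rcases h'.cases_right with ⟨m', y', r', hy, hm, -, e⟩ | ⟨i, t'', u'', -, h'', rfl, e⟩ |
      ⟨r', -, -, e⟩ | ⟨t'', u'', -, -, e⟩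
    · simp only [List.cons.injEq, Finset.singleton_inj] at e
      obtain ⟨rfl, rfl⟩ := e
      exact absurd ((h.headGE_iff _).1 hi) (not_headGE_cons hy hm _)
    · simp only [List.cons.injEq, Finset.singleton_inj] at e
      obtain ⟨rfl, rfl⟩ := e
      rw [ih h'']
    · simp at e
    · simp at e
  | empty r hr =>
    intro t' h'
    rcases h'.cases_right with ⟨m', y', r', hy, hm, -, e⟩ | ⟨i, t'', u'', -, h'', rfl, e⟩ |
      ⟨r', -, rfl, e⟩ | ⟨t'', u'', -, -, e⟩
    · simp [eq_comm] at e
    · simp [eq_comm] at e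
    · simp only [List.cons.injEq, true_and] at e
      rw [e]
    · simp only [List.cons.injEq, true_and] at e
      exact absurd e (hr _)
  | empty_empty t u h ih =>
    intro t' h'
    rcases h'.cases_right with ⟨m', y', r', hy, hm, -, e⟩ | ⟨i, t'', u'', -, h'', rfl, e⟩ |
      ⟨r', hr, rfl, e⟩ | ⟨t'', u'', h'', rfl, e⟩
    · simp [eq_comm] at e
    · simp [eq_comm] at e
    · simp only [List.cons.injEq, true_and] at e
      exact absurd e.symm (hr _)
    · simp only [List.cons.injEq, true_and] at e
      subst e
      rw [ih h'']

/-- A split creates a strict descent after `{m}`, prefixing preserves the defect, and the remaining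
rules leave empty letters. -/
theorem WordPair.not_critical {t u : List (Finset ℕ)} (h : WordPair t u) :
    ∀ l : List ℕ, l.Pairwise (· ≤ ·) → u ≠ l.map fun i => {i} := by
  induction h with
  | split m y r hy hm =>
    intro l hl e
    rcases l with _ | ⟨a, _ | ⟨b, l⟩⟩
    · simp at e
    · simp at e
    · simp only [List.map_cons, List.cons.injEq, Finset.singleton_inj] at e
      obtain ⟨rfl, rfl, -⟩ := e
      have h1 := hm b (Finset.mem_singleton_self b)
      have h2 := List.rel_of_pairwise_cons hl List.mem_cons_self
      omega
  | cons i t u hi h ih =>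
    intro l hl e
    rcases l with _ | ⟨a, l⟩
    · simp at e
    · exact ih l (List.Pairwise.of_cons hl) (List.cons.inj e).2
  | empty r hr =>
    intro l hl e
    rcases l with _ | ⟨a, l⟩ <;> simp at e
  | empty_empty t u h ih =>
    intro l hl e
    rcases l with _ | ⟨a, l⟩ <;> simp at e

theorem WordPair.goodWord_iff {n : ℕ∞} {t u : List (Finset ℕ)} (h : WordPair t u) :
    GoodWord n t ↔ GoodWord n u := by
  unfold GoodWord
  induction h with
  | split m y r hy hm => simp [or_imp, forall_and, and_assoc]
  | cons i t u hi h ih => simp only [List.forall_mem_cons, ih]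
  | empty r hr => simp
  | empty_empty t u h ih => simpa using ih

/-- The total number of factors `τ_i` in a word. -/
def wordWt (w : List (Finset ℕ)) : ℕ := (w.map Finset.card).sum

@[simp] theorem wordWt_cons (S : Finset ℕ) (w : List (Finset ℕ)) :
    wordWt (S :: w) = S.card + wordWt w := List.sum_cons

theorem WordPair.wordWt_eq {t u : List (Finset ℕ)} (h : WordPair t u) :
    wordWt t = wordWt u := by
  induction h with
  | split m y r hy hm =>
    simp only [wordWt_cons, Finset.card_singleton]
    rw [Finset.card_insert_of_notMem fun h => (hm m h).false]
    omega
  | cons i t u hi h ih => rw [wordWt_cons, wordWt_cons, ih]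
  | empty r hr => simp
  | empty_empty t u h ih => simpa using ih

/-! ### Leading terms of differentials of words -/

/-- The length-lexicographic order on words. -/
def WordLt (w w' : List (Finset ℕ)) : Prop :=
  List.Shortlex (· < ·) (w.map letterRank) (w'.map letterRank)

theorem WordLt.cons {w w' : List (Finset ℕ)} (h : WordLt w w') (S : Finset ℕ) :
    WordLt (S :: w) (S :: w') := by
  unfold WordLt
  rw [List.map_cons, List.map_cons]
  exact List.Shortlex.cons h

theorem wordLt_of_head {w w' : List (Finset ℕ)} {S T : Finset ℕ} (hl : w.length = w'.length)
    (h : letterRank S < letterRank T) : WordLt (S :: w) (T :: w') :=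
  List.Shortlex.of_lex (by simp [hl]) (List.Lex.rel h)

/-- The span of the words of the same weight that are smaller than `u`. -/
def lowWords (n : ℕ∞) (u : List (Finset ℕ)) : Submodule (ZMod 2) (Cobar n) :=
  Submodule.span (ZMod 2) {x | ∃ w, WordLt w u ∧ wordWt w = wordWt u ∧ x = word n w}

theorem word_mem_lowWords {n : ℕ∞} {w u : List (Finset ℕ)} (h : WordLt w u)
    (hw : wordWt w = wordWt u) : word n w ∈ lowWords n u :=
  Submodule.subset_span ⟨w, h, hw, rfl⟩

theorem span_mul_mem {n : ℕ∞} {s : Set (Cobar n)} {P : Submodule (ZMod 2) (Cobar n)}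
    (y : Cobar n) (h : ∀ x ∈ s, x * y ∈ P) {x : Cobar n} (hx : x ∈ Submodule.span (ZMod 2) s) :
    x * y ∈ P :=
  (Submodule.span_le (p := P.comap (LinearMap.mulRight (ZMod 2) y))).2 h hx

theorem mul_span_mem {n : ℕ∞} {s : Set (Cobar n)} {P : Submodule (ZMod 2) (Cobar n)}
    (y : Cobar n) (h : ∀ x ∈ s, y * x ∈ P) {x : Cobar n} (hx : x ∈ Submodule.span (ZMod 2) s) :
    y * x ∈ P :=
  (Submodule.span_le (p := P.comap (LinearMap.mulLeft (ZMod 2) y))).2 h hx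

theorem of1_mul_mem_lowWords {n : ℕ∞} {u : List (Finset ℕ)} (S : Finset ℕ) {x : Cobar n}
    (hx : x ∈ lowWords n u) : of1 n (eG n S) * x ∈ lowWords n (S :: u) := by
  refine mul_span_mem _ ?_ hx
  rintro _ ⟨w, hw, hwt, rfl⟩
  rw [← word_cons]
  exact word_mem_lowWords (hw.cons S) (by rw [wordWt_cons, wordWt_cons, hwt])

theorem diff_of1_eG_of_nonempty (n : ℕ∞) {S : Finset ℕ} (hS : S.Nonempty) :
    diff n (of1 n (eG n S)) =
      ∑ A ∈ (S.powerset.erase ∅).erase S, of1 n (eG n A) * of1 n (eG n (S \ A)) := by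
  have h1 : (∅ : Finset ℕ) ∈ S.powerset := Finset.empty_mem_powerset _
  have h2 : S ∈ S.powerset.erase ∅ :=
    Finset.mem_erase.2 ⟨hS.ne_empty, Finset.mem_powerset_self S⟩
  rw [diff_of1_eG, ← Finset.add_sum_erase _ _ h1, ← Finset.add_sum_erase _ _ h2,
    Finset.sdiff_empty, Finset.sdiff_self, eG_empty, ← add_assoc, ← add_assoc,
    add_assoc (_ + _) (of1 n 1 * _), cobar_add_self, zero_add]

theorem diff_of1_eG_mem (n : ℕ∞) (S : Finset ℕ) :
    diff n (of1 n (eG n S)) ∈ Submodule.span (ZMod 2)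
      {x | ∃ A B : Finset ℕ, A.card + B.card = S.card ∧ (S.Nonempty → A.Nonempty) ∧
        x = of1 n (eG n A) * of1 n (eG n B)} := by
  rcases S.eq_empty_or_nonempty with rfl | hS
  · rw [eG_empty, diff_of1_one, ← eG_empty]
    exact Submodule.subset_span ⟨∅, ∅, rfl, fun h => h, rfl⟩
  · rw [diff_of1_eG_of_nonempty n hS]
    refine Submodule.sum_mem _ fun A hA => Submodule.subset_span ⟨A, S \ A, ?_, fun _ => ?_, rfl⟩
    · simp only [Finset.mem_erase, Finset.mem_powerset] at hA
      rw [add_comm, Finset.card_sdiff_add_card_eq_card hA.2.2]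
    · simp only [Finset.mem_erase, Finset.mem_powerset] at hA
      exact Finset.nonempty_iff_ne_empty.2 hA.2.1

theorem diff_word_mem (n : ℕ∞) (w : List (Finset ℕ)) :
    diff n (word n w) ∈ Submodule.span (ZMod 2)
      {x | ∃ w', w'.length = w.length + 1 ∧ wordWt w' = wordWt w ∧ x = word n w'} := by
  induction w with
  | nil => rw [word_nil, diff_one]; exact zero_mem _
  | cons S w ih =>
    rw [word_cons, diff_mul]
    refine add_mem (mul_span_mem _ ?_ ih) (span_mul_mem _ ?_ (diff_of1_eG_mem n S))
    · rintro _ ⟨w', h1, h2, rfl⟩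
      exact Submodule.subset_span ⟨S :: w', by simp [h1], by simp [h2], (word_cons _ _ _).symm⟩
    · rintro _ ⟨A, B, h1, -, rfl⟩
      exact Submodule.subset_span ⟨A :: B :: w, by simp, by simp [← h1, add_assoc], by
        simp [mul_assoc]⟩

/-- When the differential acts behind the first letter, that letter survives, so a smaller first
letter already makes every resulting term small. -/
theorem of1_mul_diff_word_mem (n : ℕ∞) {S T : Finset ℕ} {w u : List (Finset ℕ)}
    (h : letterRank S < letterRank T) (hl : u.length = w.length + 1)
    (hw : S.card + wordWt w = T.card + wordWt u) :
    of1 n (eG n S) * diff n (word n w) ∈ lowWords n (T :: u) := by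
  refine mul_span_mem _ ?_ (diff_word_mem n w)
  rintro _ ⟨w', h1, h2, rfl⟩
  rw [← word_cons]
  exact word_mem_lowWords (wordLt_of_head (by rw [h1, hl]) h) (by simp [h2, hw])

/-- For a split, the leading term is a summand of the coproduct of the first letter. Passing a
prefix `[τ_i]` costs nothing because it is a cocycle. The empty letters are governed by `d[1] =
[1|1]`, whose square commutes with `d`. -/
theorem WordPair.diff_word_sub_mem (n : ℕ∞) {t u : List (Finset ℕ)} (h : WordPair t u) :
    diff n (word n t) - word n u ∈ lowWords n u := by
  induction h with
  | split m y r hy hm =>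
    have hmy : m ∉ y := fun h => (hm m h).false
    have hS : (insert m y).Nonempty := Finset.insert_nonempty m y
    have hmem : ({m} : Finset ℕ) ∈ ((insert m y).powerset.erase ∅).erase (insert m y) := by
      simp only [Finset.mem_erase, Finset.mem_powerset]
      refine ⟨fun h => card_insert_ne_one hy hm (by rw [← h, Finset.card_singleton]), by simp,
        by simp⟩
    have hsd : insert m y \ {m} = y := by
      rw [Finset.sdiff_singleton_eq_erase, Finset.erase_insert hmy]
    rw [word_cons, diff_mul, diff_of1_eG_of_nonempty n hS, ← Finset.add_sum_erase _ _ hmem, hsd,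
      word_cons, word_cons, add_mul, mul_assoc, add_comm, add_sub_right_comm, add_sub_cancel_left,
      Finset.sum_mul]
    refine add_mem (Submodule.sum_mem _ fun A hA => ?_) (of1_mul_diff_word_mem n ?_ (by simp) ?_)
    · simp only [Finset.mem_erase, Finset.mem_powerset] at hA
      rw [mul_assoc, ← word_cons, ← word_cons]
      refine word_mem_lowWords (wordLt_of_head (by simp) (letterRank_lt_singleton
        (Finset.nonempty_iff_ne_empty.2 hA.2.2.1) hA.1 fun k hk => ?_)) ?_
      · rcases Finset.mem_insert.1 (hA.2.2.2 hk) with rfl | hk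
        · exact le_rfl
        · exact (hm k hk).le
      · have h1 := Finset.card_sdiff_add_card_eq_card hA.2.2.2
        rw [Finset.card_insert_of_notMem hmy] at h1
        simp only [wordWt_cons, Finset.card_singleton]
        omega
    · rw [letterRank_insert hy hm, letterRank_singleton, Nat.cast_lt]
      omega
    · rw [Finset.card_insert_of_notMem hmy, wordWt_cons, Finset.card_singleton]
      omega
  | cons i t u hi h ih =>
    rw [word_cons, diff_mul, eG_singleton, diff_of1_tauG, zero_mul, add_zero, word_cons, ← eG_singleton,
      ← mul_sub]
    exact of1_mul_mem_lowWords _ ih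
  | empty r hr =>
    rw [word_cons, diff_mul, eG_empty, diff_of1_one, word_cons, word_cons, eG_empty,
      mul_assoc, add_sub_cancel_right, ← eG_empty]
    apply of1_mul_mem_lowWords
    rcases r with _ | ⟨y, r⟩
    · rw [word_nil, diff_one]
      exact zero_mem _
    · have hy : y.Nonempty := Finset.nonempty_iff_ne_empty.2 fun h => hr r (by rw [h])
      rw [word_cons, diff_mul]
      refine add_mem (of1_mul_diff_word_mem n ?_ (by simp) (by simp))
        (span_mul_mem _ ?_ (diff_of1_eG_mem n y))
      · rw [letterRank_empty]
        exact letterRank_lt_top hy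
      · rintro _ ⟨A, B, h1, h2, rfl⟩
        rw [mul_assoc, ← word_cons, ← word_cons]
        refine word_mem_lowWords (wordLt_of_head (by simp) ?_) (by simp [← h1, add_assoc])
        rw [letterRank_empty]
        exact letterRank_lt_top (h2 hy)
  | empty_empty t u h ih =>
    have h1 : diff n (word n (∅ :: ∅ :: ∅ :: t)) - word n (∅ :: ∅ :: ∅ :: u) =
        of1 n (eG n ∅) * (of1 n (eG n ∅) * (diff n (word n (∅ :: t)) - word n (∅ :: u))) := by
      simp only [word_cons n _ (∅ :: ∅ :: t), word_cons n _ (∅ :: ∅ :: u), word_cons n _ (∅ :: t),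
        word_cons n _ (∅ :: u)]
      generalize word n (∅ :: t) = x
      generalize word n (∅ :: u) = y
      rw [eG_empty, diff_mul, diff_mul, diff_of1_one]
      simp only [mul_add, mul_sub, mul_assoc]
      -- The contributions of the two outer letters `[1]` cancel, so `d` passes through `[1|1]`.
      rw [add_assoc, cobar_add_self, add_zero]
    rw [h1]
    exact of1_mul_mem_lowWords _ (of1_mul_mem_lowWords _ ih)

theorem diff_word_singletons (n : ℕ∞) (l : List ℕ) :
    diff n (word n (l.map fun i => {i})) = 0 := by
  induction l with
  | nil => rw [List.map_nil, word_nil, diff_one]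
  | cons i l ih =>
    rw [List.map_cons, word_cons, diff_mul, ih, eG_singleton, diff_of1_tauG, mul_zero, zero_mul,
      add_zero]

/-! ### Algebraic Morse theory -/

section Morse

variable {k C B X : Type} [CommRing k] [AddCommGroup C] [Module k C]

/-- The span of the basis elements whose index is smaller than `γ`. -/
def lowSpan (k : Type) {C B : Type} [CommRing k] [AddCommGroup C] [Module k C] (b : B → C)
    (r : B → B → Prop) (γ : B) : Submodule k C :=
  Submodule.span k (b '' {β | r β γ})

/-- A family whose members have distinct leading terms is linearly independent. -/
theorem linearIndependent_of_lead (b : B → C) (good : B → Prop)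
    (hcoord : ∀ β, good β → ∃ f : C →ₗ[k] k, f (b β) = 1 ∧ ∀ β', β' ≠ β → f (b β') = 0)
    (r : B → B → Prop) [IsWellFounded B r] {Y : Type} (lead : Y → B) (val : Y → C)
    (hlead : Function.Injective lead) (hgood : ∀ y, good (lead y))
    (hval : ∀ y, val y - b (lead y) ∈ lowSpan k b r (lead y)) : LinearIndependent k val := by
  classical
  rw [linearIndependent_iff']
  intro s g hg
  by_contra! hne
  have hs : (s.filter fun y => g y ≠ 0).Nonempty := by
    obtain ⟨y, hy, hgy⟩ := hne
    exact ⟨y, Finset.mem_filter.2 ⟨hy, hgy⟩⟩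
  -- The relation `r` need not be total, so its ordinal rank is maximized; no lower-order term in
  -- the sum can then involve `lead y₀`.
  obtain ⟨y₀, hy₀, hmax⟩ :=
    Finset.exists_max_image _ (fun y => IsWellFounded.rank r (lead y)) hs
  rw [Finset.mem_filter] at hy₀
  obtain ⟨f, hf1, hf0⟩ := hcoord (lead y₀) (hgood y₀)
  have hlow : ∀ y ∈ s, g y ≠ 0 → f (val y) = f (b (lead y)) := by
    intro y hy hgy
    rw [← sub_eq_zero, ← map_sub]
    have h1 : lowSpan k b r (lead y) ≤ LinearMap.ker f := by
      rw [lowSpan, Submodule.span_le]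
      rintro _ ⟨β, hβ, rfl⟩
      refine hf0 β ?_
      rintro rfl
      exact absurd (IsWellFounded.rank_lt_of_rel hβ)
        (not_lt.2 (hmax y (Finset.mem_filter.2 ⟨hy, hgy⟩)))
    exact h1 (hval y)
  have h := congrArg f hg
  rw [map_sum, map_zero, Finset.sum_eq_single y₀] at h
  · rw [map_smul, hlow y₀ hy₀.1 hy₀.2, hf1, smul_eq_mul, mul_one] at h
    exact hy₀.2 h
  · intro y hy hyne
    by_cases hgy : g y = 0
    · rw [hgy, zero_smul, map_zero]
    · rw [map_smul, hlow y hy hgy, hf0 _ (hlead.ne hyne), smul_zero]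
  · exact fun h => absurd hy₀.1 h

/-- If the basis elements of a complex are matched up to critical ones, in such a way that the
second member of each pair is the leading term of the differential of the first and each critical
element is the leading term of a cycle, then these cycles form a basis of the homology. -/
theorem homology_basis_of_matching (d : C →ₗ[k] C) (hd : ∀ x, d (d x) = 0) (b : B → C)
    (good : B → Prop) (hbad : ∀ β, ¬ good β → b β = 0)
    (hspan : ∀ x, x ∈ Submodule.span k (Set.range b))
    (hcoord : ∀ β, good β → ∃ f : C →ₗ[k] k, f (b β) = 1 ∧ ∀ β', β' ≠ β → f (b β') = 0)
    (r : B → B → Prop) (hr : WellFounded r) (pair : B → B → Prop) (crit : X → B) (rep : X → C)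
    (hpair_good : ∀ β γ, pair β γ → good γ) (hcrit_good : ∀ x, good (crit x))
    (hpair_inj : ∀ β β' γ, pair β γ → pair β' γ → β = β') (hcrit_inj : Function.Injective crit)
    (hpair_crit : ∀ β x, ¬ pair β (crit x))
    (hcover : ∀ β, good β → (∃ γ, pair β γ) ∨ (∃ γ, pair γ β) ∨ ∃ x, crit x = β)
    (hpair : ∀ β γ, pair β γ → d (b β) - b γ ∈ lowSpan k b r γ)
    (hrep : ∀ x, rep x - b (crit x) ∈ lowSpan k b r (crit x)) (hcycle : ∀ x, d (rep x) = 0) :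
    (∀ z, d z = 0 → ∃ (c : X →₀ k) (w : C), z = Finsupp.linearCombination k rep c + d w) ∧
      ∀ (c : X →₀ k) (w : C), Finsupp.linearCombination k rep c = d w → c = 0 := by
  classical
  have : IsWellFounded B r := ⟨hr⟩
  let P : Type := {p : B × B // pair p.1 p.2}
  let up : P → C := fun p => b p.1.1
  let lead : P ⊕ X → B := Sum.elim (fun p => p.1.2) crit
  let val : P ⊕ X → C := Sum.elim (fun p => d (up p)) rep
  -- The boundaries of the first members and the lifted critical elements have distinct leading
  -- terms. This independence carries both conclusions.
  have hli : LinearIndependent k val := by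
    refine linearIndependent_of_lead b good hcoord r lead val ?_ ?_ ?_
    · rintro (⟨⟨β, γ⟩, h⟩ | x) (⟨⟨β', γ'⟩, h'⟩ | x') e
      · obtain rfl : γ = γ' := e
        obtain rfl := hpair_inj _ _ _ h h'
        rfl
      · obtain rfl : γ = crit x' := e
        exact absurd h (hpair_crit _ _)
      · obtain rfl : crit x = γ' := e
        exact absurd h' (hpair_crit _ _)
      · rw [hcrit_inj e]
    · rintro (p | x)
      · exact hpair_good _ _ p.2
      · exact hcrit_good x
    · rintro (p | x)
      · exact hpair _ _ p.2
      · exact hrep x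
  have hM : ∀ z, ∃ (f : P →₀ k) (c : X →₀ k) (w : C),
      z = Finsupp.linearCombination k up f + Finsupp.linearCombination k rep c + d w := by
    set M : Submodule k C := LinearMap.range (Finsupp.linearCombination k up) ⊔
      LinearMap.range (Finsupp.linearCombination k rep) ⊔ LinearMap.range d with hMdef
    have hup : ∀ p, up p ∈ M := fun p =>
      Submodule.mem_sup_left (Submodule.mem_sup_left ⟨Finsupp.single p 1, by simp⟩)
    have hrepM : ∀ x, rep x ∈ M := fun x =>
      Submodule.mem_sup_left (Submodule.mem_sup_right ⟨Finsupp.single x 1, by simp⟩)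
    have hdM : ∀ x, d x ∈ M := fun x => Submodule.mem_sup_right ⟨x, rfl⟩
    -- By well-founded induction, a second member or a critical element is replaced by its boundary
    -- or cycle modulo smaller basis elements.
    have hb : ∀ β, b β ∈ M := by
      intro β
      induction β using hr.induction with
      | _ β ih =>
      have hlow : lowSpan k b r β ≤ M := by
        rw [lowSpan, Submodule.span_le]
        rintro _ ⟨γ, hγ, rfl⟩
        exact ih γ hγ
      by_cases hβ : good β
      · rcases hcover β hβ with ⟨γ, h⟩ | ⟨γ, h⟩ | ⟨x, rfl⟩
        · exact hup ⟨(β, γ), h⟩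
        · have := sub_mem (hdM (b γ)) (hlow (hpair _ _ h))
          rwa [sub_sub_cancel] at this
        · have := sub_mem (hrepM x) (hlow (hrep x))
          rwa [sub_sub_cancel] at this
      · rw [hbad β hβ]
        exact zero_mem _
    intro z
    have hz : z ∈ M := by
      have : Submodule.span k (Set.range b) ≤ M := by
        rw [Submodule.span_le]
        rintro _ ⟨β, rfl⟩
        exact hb β
      exact this (hspan z)
    obtain ⟨y, hy, _, ⟨w, rfl⟩, rfl⟩ := Submodule.mem_sup.1 hz
    obtain ⟨_, ⟨f, rfl⟩, _, ⟨c, rfl⟩, rfl⟩ := Submodule.mem_sup.1 hy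
    exact ⟨f, c, w, rfl⟩
  have hdrep : ∀ c : X →₀ k, d (Finsupp.linearCombination k rep c) = 0 := by
    intro c
    rw [Finsupp.linearCombination_apply, Finsupp.sum, map_sum]
    exact Finset.sum_eq_zero fun x _ => by rw [map_smul, hcycle, smul_zero]
  have hval : ∀ (f : P →₀ k) (c : X →₀ k),
      d (Finsupp.linearCombination k up f) + Finsupp.linearCombination k rep c = 0 →
        f = 0 ∧ c = 0 := by
    intro f c h
    have h1 : Finsupp.linearCombination k val (Finsupp.sumElim f c) = 0 := by
      rw [Finsupp.linearCombination_apply, Finsupp.sum_sumElim, ← h]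
      rw [Finsupp.linearCombination_apply, Finsupp.linearCombination_apply, Finsupp.sum,
        Finsupp.sum, Finsupp.sum, Finsupp.sum, map_sum]
      simp [val]
    have h2 := (linearIndependent_iff.1 hli) _ h1
    constructor
    · ext p
      simpa using DFunLike.congr_fun h2 (Sum.inl p)
    · ext x
      simpa using DFunLike.congr_fun h2 (Sum.inr x)
  constructor
  · intro z hz
    obtain ⟨f, c, w, rfl⟩ := hM z
    rw [map_add, map_add, hd, hdrep, add_zero] at hz
    obtain ⟨rfl, -⟩ := hval f 0 (by rw [← add_zero (d _)] at hz; simpa using hz)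
    exact ⟨c, w, by rw [map_zero, zero_add]⟩
  · intro c w h
    obtain ⟨f, c', w', rfl⟩ := hM w
    rw [map_add, map_add, hd, hdrep, add_zero, add_zero] at h
    exact neg_eq_zero.1 (hval f (-c) (by rw [map_neg, h, add_neg_cancel])).2

end Morse

/-! ### The matching on the basis of the cobar complex -/

/-- The order on indices: first by the degree that is complementary to the exponent of `ρ`, then
by the order on words. -/
def IdxLt (β β' : CobarIdx) : Prop :=
  Prod.Lex (· < ·) (List.Shortlex (· < ·))
    (2 * β.2.1 + wordWt β.2.2, β.2.2.map letterRank)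
    (2 * β'.2.1 + wordWt β'.2.2, β'.2.2.map letterRank)

theorem idxLt_wellFounded : WellFounded IdxLt :=
  InvImage.wf (fun β : CobarIdx => (2 * β.2.1 + wordWt β.2.2, β.2.2.map letterRank))
    (WellFounded.prod_lex wellFounded_lt (List.Shortlex.wf wellFounded_lt))

theorem IdxLt.of_wt {p a p' a' : ℕ} {w w' : List (Finset ℕ)}
    (h : 2 * a + wordWt w < 2 * a' + wordWt w') : IdxLt (p, a, w) (p', a', w') :=
  Prod.Lex.left _ _ h

theorem IdxLt.of_word {p p' a : ℕ} {w w' : List (Finset ℕ)} (h : WordLt w w')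
    (hw : wordWt w = wordWt w') : IdxLt (p, a, w) (p', a, w') := by
  unfold IdxLt
  dsimp only
  rw [hw]
  exact Prod.Lex.right _ h

abbrev lowIdx (n : ℕ∞) (β : CobarIdx) : Submodule (ZMod 2) (Cobar n) :=
  lowSpan (ZMod 2) (cobarMon n) IdxLt β

theorem cobarMon_mem_lowIdx {n : ℕ∞} {β γ : CobarIdx} (h : IdxLt β γ) :
    cobarMon n β ∈ lowIdx n γ :=
  Submodule.subset_span ⟨β, h, rfl⟩

theorem of0_mul_mem_lowIdx {n : ℕ∞} (p a : ℕ) {u : List (Finset ℕ)} {x : Cobar n}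
    (hx : x ∈ lowWords n u) : of0 n (rho ^ p * tau ^ a) * x ∈ lowIdx n (p, a, u) := by
  refine mul_span_mem _ ?_ hx
  rintro _ ⟨w, h1, h2, rfl⟩
  exact cobarMon_mem_lowIdx (β := (p, a, w)) (IdxLt.of_word h1 h2)

/-- This is the degree balance of the right unit: what is gained in the exponent of `ρ` is lost from
`2a` plus the weight. -/
theorem rhoWt_add_card (S : Finset ℕ) : rhoWt S + S.card = 2 * binVal S := by
  rw [rhoWt, binVal, Finset.mul_sum, Finset.card_eq_sum_ones, ← Finset.sum_add_distrib]
  exact Finset.sum_congr rfl fun i _ => by rw [rhoLen_add_one, pow_succ']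

theorem binVal_sdiff_add {S T : Finset ℕ} (h : S ⊆ T) : binVal (T \ S) + binVal S = binVal T :=
  Finset.sum_sdiff h

theorem rhoWt_pos {S : Finset ℕ} (h : S.Nonempty) : 0 < rhoWt S := by
  obtain ⟨k, hk⟩ := h
  exact (rhoLen_pos k).trans_le (rhoLen_le_rhoWt hk le_rfl)

theorem rhoLen_lt_rhoWt {i : ℕ} {S : Finset ℕ} (hS : S.Nonempty) (h : S ≠ {i})
    (hi : ∀ k ∈ S, i ≤ k) : rhoLen i < rhoWt S := by
  obtain ⟨k, hk, hki⟩ : ∃ k ∈ S, k ≠ i := by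
    by_contra! h'
    exact h (Finset.eq_singleton_iff_nonempty_unique_mem.2 ⟨hS, h'⟩)
  exact (rhoLen_strictMono (lt_of_le_of_ne (hi k hk) hki.symm)).trans_le
    (rhoLen_le_rhoWt hk le_rfl)

theorem of1_etaQuot_mul_word (n : ℕ∞) (p i a : ℕ) (w : List (Finset ℕ)) :
    of0 n (rho ^ p) * (of1 n (etaQuot n i a) * word n w) =
      ∑ S ∈ (bits a).powerset.erase ∅,
        cobarMon n (p + (rhoWt S - rhoLen i), binVal (bits a \ S), S :: w) := by
  rw [etaQuot, map_sum, Finset.sum_mul, Finset.mul_sum]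
  refine Finset.sum_congr rfl fun S _ => ?_
  rw [of1_smul, cobarMon, word_cons, mul_assoc, ← mul_assoc, of0_mul, ← mul_assoc (rho ^ p),
    ← pow_add]

/-- Differentiating the coefficient raises the exponent of `ρ` and hence lowers `2a` plus the
weight. Differentiating the word keeps the coefficient, and there the leading term is known from
`diff_word_sub_mem`. -/
theorem wordPair_diff_mem (n : ℕ∞) (p a : ℕ) {t u : List (Finset ℕ)} (h : WordPair t u) :
    diff n (cobarMon n (p, a, t)) - cobarMon n (p, a, u) ∈ lowIdx n (p, a, u) := by
  have h1 : diff n (of0 n (rho ^ p * tau ^ a)) * word n t ∈ lowIdx n (p, a, u) := by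
    rw [← of0_mul, diff_of0_rho_pow_mul, diff_of0_tau_pow n (i := 0) (by simp), ← mul_assoc,
      of0_mul, ← pow_add, mul_assoc, of1_etaQuot_mul_word]
    refine Submodule.sum_mem _ fun S hS => cobarMon_mem_lowIdx (IdxLt.of_wt ?_)
    rw [Finset.mem_erase, Finset.mem_powerset] at hS
    have e1 := rhoWt_add_card S
    have e2 := binVal_sdiff_add hS.2
    have e3 := rhoWt_pos (Finset.nonempty_iff_ne_empty.2 hS.1)
    rw [binVal_bits] at e2
    rw [wordWt_cons, h.wordWt_eq]
    omega
  simp only [cobarMon] at h1 ⊢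
  rw [diff_mul, add_sub_right_comm, ← mul_sub]
  exact add_mem (of0_mul_mem_lowIdx p a (h.diff_word_sub_mem n)) h1

/-- The cocycle `ρ ^ p v_i(j) [w]` has the leading term `ρ ^ p τ ^ (2 ^ (i + 1) j) [τ_i|w]`. -/
theorem of1_etaQuot_lead (n : ℕ∞) (p i j : ℕ) (w : List (Finset ℕ)) :
    of0 n (rho ^ p) * (of1 n (etaQuot n i (2 ^ i * (2 * j + 1))) * word n w) -
      cobarMon n (p, 2 ^ (i + 1) * j, {i} :: w) ∈ lowIdx n (p, 2 ^ (i + 1) * j, {i} :: w) := by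
  have hi : i ∉ bits (2 ^ (i + 1) * j) := fun h =>
    absurd (le_of_mem_bits (Dvd.intro _ rfl) h) (by omega)
  have hb := bits_two_pow_mul_odd i j
  have hmem : ({i} : Finset ℕ) ∈ (bits (2 ^ i * (2 * j + 1))).powerset.erase ∅ := by
    simp [hb]
  have hd : bits (2 ^ i * (2 * j + 1)) \ {i} = bits (2 ^ (i + 1) * j) := by
    rw [hb, Finset.sdiff_singleton_eq_erase, Finset.erase_insert hi]
  have hr : rhoWt {i} = rhoLen i := by simp [rhoWt]
  rw [of1_etaQuot_mul_word, ← Finset.add_sum_erase _ _ hmem, hd, hr, Nat.sub_self, add_zero,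
    binVal_bits, add_sub_cancel_left]
  refine Submodule.sum_mem _ fun S hS => cobarMon_mem_lowIdx (IdxLt.of_wt ?_)
  simp only [Finset.mem_erase, Finset.mem_powerset] at hS
  have e1 := rhoWt_add_card S
  have e2 := binVal_sdiff_add hS.2.2
  have e3 := rhoLen_lt_rhoWt (Finset.nonempty_iff_ne_empty.2 hS.2.1) hS.1 fun k hk =>
    le_of_mem_bits (Dvd.intro _ rfl) (hS.2.2 hk)
  have e4 := rhoLen_add_one i
  rw [binVal_bits] at e2
  rw [wordWt_cons, wordWt_cons, Finset.card_singleton]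
  have e5 : 2 * (2 ^ i * (2 * j + 1)) = 2 * (2 ^ (i + 1) * j) + 2 ^ (i + 1) := by ring
  omega

theorem diff_of0_tau_pow_mul_singletons (n : ℕ∞) (p i a : ℕ) (h : 2 ^ i ∣ a) (l : List ℕ) :
    diff n (cobarMon n (p, a, l.map fun k => {k})) =
      of0 n (rho ^ (p + rhoLen i)) *
        (of1 n (etaQuot n i a) * word n (l.map fun k => {k})) := by
  rw [cobarMon, ← of0_mul, mul_assoc, diff_of0_rho_pow_mul, diff_mul, diff_word_singletons,
    mul_zero, zero_add, diff_of0_tau_pow n h, pow_add, ← of0_mul, mul_assoc, mul_assoc]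

/-- The matching on the basis of the cobar complex. -/
inductive IdxPair (n : ℕ∞) : CobarIdx → CobarIdx → Prop
  | word (p a : ℕ) (t u : List (Finset ℕ)) (h : WordPair t u) (hu : GoodWord n u) :
      IdxPair n (p, a, t) (p, a, u)
  | bit (p i j : ℕ) (l : List ℕ) (hi : (i : ℕ∞) ≤ n) (hl : ∀ k ∈ l, i ≤ k ∧ (k : ℕ∞) ≤ n)
      (hs : l.Pairwise (· ≤ ·)) :
      IdxPair n (p, 2 ^ i * (2 * j + 1), l.map fun k => {k})
        (p + rhoLen i, 2 ^ (i + 1) * j, {i} :: l.map fun k => {k})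

/-- The indices of the unmatched basis elements. -/
inductive Crit (n : ℕ∞) : Type
  | free (p a : ℕ) (ha : ∀ i : ℕ, (i : ℕ∞) ≤ n → 2 ^ (i + 1) ∣ a)
  | torsion (p i j : ℕ) (l : List ℕ) (hp : p < rhoLen i) (hi : (i : ℕ∞) ≤ n)
      (hl : ∀ k ∈ l, i ≤ k ∧ (k : ℕ∞) ≤ n) (hs : l.Pairwise (· ≤ ·))

def Crit.idx {n : ℕ∞} : Crit n → CobarIdx
  | free p a _ => (p, a, [])
  | torsion p i j l _ _ _ _ => (p, 2 ^ (i + 1) * j, {i} :: l.map fun k => {k})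

/-- The cocycle whose leading term is a given unmatched basis element. -/
def Crit.rep {n : ℕ∞} : Crit n → Cobar n
  | free p a _ => of0 n (rho ^ p * tau ^ a)
  | torsion p i j l _ _ _ _ => of0 n (rho ^ p) *
      (of1 n (etaQuot n i (2 ^ i * (2 * j + 1))) * word n (l.map fun k => {k}))

theorem goodWord_singletons {n : ℕ∞} {l : List ℕ} :
    GoodWord n (l.map fun k => {k}) ↔ ∀ k ∈ l, (k : ℕ∞) ≤ n := by
  simp [GoodWord]

theorem goodWord_cons {n : ℕ∞} {i : ℕ} {w : List (Finset ℕ)} :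
    GoodWord n ({i} :: w) ↔ (i : ℕ∞) ≤ n ∧ GoodWord n w := by
  simp [GoodWord]

theorem map_singleton_injective :
    Function.Injective (List.map fun k : ℕ => ({k} : Finset ℕ)) :=
  List.map_injective_iff.2 Finset.singleton_injective

theorem pairwise_cons_of_le {n : ℕ∞} {i : ℕ} {l : List ℕ} (hl : ∀ k ∈ l, i ≤ k ∧ (k : ℕ∞) ≤ n)
    (hs : l.Pairwise (· ≤ ·)) : (i :: l).Pairwise (· ≤ ·) :=
  List.Pairwise.cons (fun k hk => (hl k hk).1) hs

theorem diff_rep {n : ℕ∞} (x : Crit n) : diff n x.rep = 0 := by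
  cases x with
  | free p a ha =>
    rw [Crit.rep, ← of0_mul, diff_of0_rho_pow_mul, diff_of0_tau_pow n (i := 0) (by simp),
      etaQuot_eq_zero, map_zero, mul_zero, mul_zero]
    intro k hk
    by_contra hkn
    have := le_of_mem_bits (ha k (not_lt.1 hkn)) hk
    omega
  | torsion p i j l hp hi hl hs =>
    rw [Crit.rep, diff_of0_rho_pow_mul, diff_mul, diff_word_singletons,
      diff_of1_etaQuot n (Dvd.intro _ rfl), mul_zero, zero_mul, add_zero, mul_zero]

/-- Once the word is nondecreasing with first index `k`, compare `k` with the `2`-adic valuation `i`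
of `a`. If `i ≤ k`, the element supports a Bockstein differential. Otherwise it is hit by one or,
for small powers of `ρ`, is critical. -/
theorem idxPair_cover (n : ℕ∞) (β : CobarIdx) (hβ : GoodIdx n β) :
    (∃ γ, IdxPair n β γ) ∨ (∃ γ, IdxPair n γ β) ∨ ∃ x : Crit n, x.idx = β := by
  obtain ⟨p, a, w⟩ := β
  have hw : GoodWord n w := hβ
  rcases wordPair_cover w with ⟨u, hu⟩ | ⟨t, ht⟩ | ⟨l, hl, rfl⟩
  · exact Or.inl ⟨_, IdxPair.word p a _ _ hu (hu.goodWord_iff.1 hw)⟩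
  · exact Or.inr (Or.inl ⟨_, IdxPair.word p a _ _ ht hw⟩)
  rw [goodWord_singletons] at hw
  have key : ∀ i j : ℕ, a = 2 ^ i * (2 * j + 1) → (i : ℕ∞) ≤ n → (∀ k ∈ l, i ≤ k) →
      ∃ γ, IdxPair n (p, a, l.map fun k => {k}) γ := by
    rintro i j rfl hi hil
    exact ⟨_, IdxPair.bit p i j l hi (fun k hk => ⟨hil k hk, hw k hk⟩) hl⟩
  have hodd : ∀ m, ¬ 2 ^ (m + 1) ∣ a → ∃ i j, i ≤ m ∧ a = 2 ^ i * (2 * j + 1) := by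
    intro m hm
    obtain ⟨i, b, ⟨j, rfl⟩, rfl⟩ := Nat.exists_eq_two_pow_mul_odd (n := a) (by
      rintro rfl
      exact hm (dvd_zero _))
    refine ⟨i, j, ?_, rfl⟩
    by_contra hi
    exact hm (Dvd.dvd.mul_right (pow_dvd_pow 2 (by omega)) _)
  rcases l with _ | ⟨k, l⟩
  · by_cases ha : ∀ i : ℕ, (i : ℕ∞) ≤ n → 2 ^ (i + 1) ∣ a
    · exact Or.inr (Or.inr ⟨Crit.free p a ha, rfl⟩)
    · push Not at ha
      obtain ⟨m, hm, hma⟩ := ha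
      obtain ⟨i, j, him, rfl⟩ := hodd m hma
      exact Or.inl (key i j rfl ((Nat.cast_le.2 him).trans hm) (by simp))
  · have hkl : ∀ m ∈ l, k ≤ m ∧ (m : ℕ∞) ≤ n := fun m hm =>
      ⟨List.rel_of_pairwise_cons hl hm, hw m (List.mem_cons_of_mem _ hm)⟩
    have hk : (k : ℕ∞) ≤ n := hw k List.mem_cons_self
    by_cases ha : 2 ^ (k + 1) ∣ a
    · obtain ⟨j, rfl⟩ := ha
      by_cases hp : p < rhoLen k
      · exact Or.inr (Or.inr ⟨Crit.torsion p k j l hp hk hkl hl.of_cons, rfl⟩)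
      -- The exponent of `ρ` is large enough to undo the differential on `τ^(2^k (2j+1))`.
      · have := IdxPair.bit (p - rhoLen k) k j l hk hkl hl.of_cons
        rw [Nat.sub_add_cancel (not_lt.1 hp)] at this
        exact Or.inr (Or.inl ⟨_, this⟩)
    · obtain ⟨i, j, him, rfl⟩ := hodd k ha
      refine Or.inl (key i j rfl ((Nat.cast_le.2 him).trans hk) fun m hm => ?_)
      rcases List.mem_cons.1 hm with rfl | hm
      · exact him
      · exact him.trans (hkl m hm).1

theorem two_pow_mul_left_cancel {i a b : ℕ} (h : 2 ^ i * a = 2 ^ i * b) : a = b :=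
  Nat.eq_of_mul_eq_mul_left (Nat.two_pow_pos i) h

theorem Crit.idx_injective {n : ℕ∞} : Function.Injective (Crit.idx (n := n)) := by
  rintro (⟨p, a, ha⟩ | ⟨p, i, j, l, hp, hi, hl, hs⟩)
    (⟨p', a', ha'⟩ | ⟨p', i', j', l', hp', hi', hl', hs'⟩) e
  · simp only [Crit.idx, Prod.mk.injEq] at e
    obtain ⟨rfl, rfl, -⟩ := e
    rfl
  · simp [Crit.idx] at e
  · simp [Crit.idx] at e
  · simp only [Crit.idx, Prod.mk.injEq, List.cons.injEq, Finset.singleton_inj] at e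
    obtain ⟨rfl, h, rfl, h'⟩ := e
    obtain rfl := two_pow_mul_left_cancel h
    obtain rfl := map_singleton_injective h'
    rfl

/-- The two kinds of pairs cannot share a target: Bockstein targets have nondecreasing singleton
words, which `not_critical` excludes for word pairs. -/
theorem idxPair_left_unique {n : ℕ∞} {β β' γ : CobarIdx} (h : IdxPair n β γ)
    (h' : IdxPair n β' γ) : β = β' := by
  rcases h with ⟨p, a, t, u, h, hu⟩ | ⟨p, i, j, l, hi, hl, hs⟩
  · generalize hγ : (p, a, u) = γ at h'
    rcases h' with ⟨p', a', t', u', h', hu'⟩ | ⟨p', i', j', l', hi', hl', hs'⟩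
    · simp only [Prod.mk.injEq] at hγ
      obtain ⟨rfl, rfl, rfl⟩ := hγ
      rw [h.left_unique h']
    · simp only [Prod.mk.injEq] at hγ
      exact absurd hγ.2.2 (h.not_critical (i' :: l') (pairwise_cons_of_le hl' hs'))
  · generalize hγ : (p + rhoLen i, 2 ^ (i + 1) * j, {i} :: l.map fun k => ({k} : Finset ℕ)) = γ
      at h'
    rcases h' with ⟨p', a', t', u', h', hu'⟩ | ⟨p', i', j', l', hi', hl', hs'⟩
    · simp only [Prod.mk.injEq] at hγ
      exact absurd hγ.2.2.symm (h'.not_critical (i :: l) (pairwise_cons_of_le hl hs))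
    · simp only [Prod.mk.injEq, List.cons.injEq, Finset.singleton_inj] at hγ
      obtain ⟨h1, h2, rfl, h3⟩ := hγ
      obtain rfl := two_pow_mul_left_cancel h2
      obtain rfl := map_singleton_injective h3
      rw [Nat.add_right_cancel h1]

theorem not_idxPair_crit {n : ℕ∞} (β : CobarIdx) (x : Crit n) : ¬ IdxPair n β x.idx := by
  intro h
  generalize hγ : x.idx = γ at h
  rcases h with ⟨p, a, t, u, h, hu⟩ | ⟨p, i, j, l, hi, hl, hs⟩
  · rcases x with ⟨p', a', ha'⟩ | ⟨p', i', j', l', hp', hi', hl', hs'⟩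
    · simp only [Crit.idx, Prod.mk.injEq] at hγ
      exact h.not_critical [] List.Pairwise.nil hγ.2.2.symm
    · simp only [Crit.idx, Prod.mk.injEq] at hγ
      exact h.not_critical (i' :: l') (pairwise_cons_of_le hl' hs') hγ.2.2.symm
  · rcases x with ⟨p', a', ha'⟩ | ⟨p', i', j', l', hp', hi', hl', hs'⟩
    · simp [Crit.idx] at hγ
    · simp only [Crit.idx, Prod.mk.injEq, List.cons.injEq, Finset.singleton_inj] at hγ
      obtain ⟨h1, -, rfl, -⟩ := hγ
      omega

/-- The cocycles `Crit.rep` form a basis of the cohomology of the cobar complex. -/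
theorem cobar_homology_basis (n : ℕ∞) :
    (∀ z, diff n z = 0 → ∃ (c : Crit n →₀ ZMod 2) (w : Cobar n),
      z = Finsupp.linearCombination (ZMod 2) Crit.rep c + diff n w) ∧
    ∀ (c : Crit n →₀ ZMod 2) (w : Cobar n),
      Finsupp.linearCombination (ZMod 2) Crit.rep c = diff n w → c = 0 := by
  refine homology_basis_of_matching (diff n) (diff_diff n) (cobarMon n) (GoodIdx n) ?_
    (mem_span_cobarMon n) (exists_coord n) IdxLt idxLt_wellFounded (IdxPair n) Crit.idx Crit.rep
    ?_ ?_ (fun β β' γ => idxPair_left_unique) Crit.idx_injective not_idxPair_crit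
    (idxPair_cover n) ?_ ?_ diff_rep
  · intro β hβ
    rw [cobarMon, word_eq_zero hβ, mul_zero]
  · rintro β γ (⟨p, a, t, u, h, hu⟩ | ⟨p, i, j, l, hi, hl, hs⟩)
    · exact hu
    · exact goodWord_cons.2 ⟨hi, goodWord_singletons.2 fun k hk => (hl k hk).2⟩
  · rintro (⟨p, a, ha⟩ | ⟨p, i, j, l, hp, hi, hl, hs⟩)
    · simp [GoodIdx, GoodWord, Crit.idx]
    · exact goodWord_cons.2 ⟨hi, goodWord_singletons.2 fun k hk => (hl k hk).2⟩
  · rintro β γ (⟨p, a, t, u, h, hu⟩ | ⟨p, i, j, l, hi, hl, hs⟩)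
    · exact wordPair_diff_mem n p a h
    · rw [diff_of0_tau_pow_mul_singletons n p i _ (Dvd.intro _ rfl)]
      exact of1_etaQuot_lead n (p + rhoLen i) i j _
  · rintro (⟨p, a, ha⟩ | ⟨p, i, j, l, hp, hi, hl, hs⟩)
    · simp only [Crit.rep, Crit.idx, cobarMon, word_nil, mul_one, sub_self]
      exact zero_mem _
    · exact of1_etaQuot_lead n p i j _

/-! ### Classes in `Ext` and their relations -/

/-- The class of a cocycle. -/
def cls (n : ℕ∞) (z : Cobar n) (hz : diff n z = 0) : Ext n := ((⟨z, hz⟩ : cocycles n) : Ext n)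

theorem cls_represents {n : ℕ∞} {z : Cobar n} (hz : diff n z = 0) :
    Represents n z (cls n z hz) := ⟨hz, rfl⟩

theorem diff_mul_eq_zero {n : ℕ∞} {x y : Cobar n} (hx : diff n x = 0) (hy : diff n y = 0) :
    diff n (x * y) = 0 := by
  rw [diff_mul, hx, hy, mul_zero, zero_mul, add_zero]

theorem cls_mul {n : ℕ∞} {x y : Cobar n} (hx : diff n x = 0) (hy : diff n y = 0) :
    cls n x hx * cls n y hy = cls n (x * y) (diff_mul_eq_zero hx hy) := rfl

theorem cls_one (n : ℕ∞) : cls n 1 (diff_one n) = 1 := rfl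

theorem cls_eq {n : ℕ∞} {x y : Cobar n} (hx : diff n x = 0) (hy : diff n y = 0) (w : Cobar n)
    (h : x - y = diff n w) : cls n x hx = cls n y hy :=
  ((cohomologous n).eq).2 ⟨w, h⟩

theorem cls_eq_zero_iff {n : ℕ∞} {x : Cobar n} (hx : diff n x = 0) :
    cls n x hx = 0 ↔ ∃ w, x = diff n w := by
  constructor
  · intro h
    obtain ⟨w, hw⟩ := ((cohomologous n).eq).1
      (h.trans (rfl : (0 : Ext n) = ((0 : cocycles n) : Ext n)))
    exact ⟨w, by simpa using hw⟩
  · rintro ⟨w, hw⟩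
    exact cls_eq hx (map_zero _) w (by rw [sub_zero, hw])

theorem cls_pow {n : ℕ∞} {a : M2} (h : diff n (of0 n a) = 0) (k : ℕ)
    (hk : diff n (of0 n (a ^ k)) = 0) : cls n (of0 n a) h ^ k = cls n (of0 n (a ^ k)) hk := by
  induction k with
  | zero => simp only [pow_zero, of0_one]; rfl
  | succ k ih =>
    have hk' : diff n (of0 n (a ^ k)) = 0 := by
      rw [of0_pow]
      exact pow_mem (S := cocycles n) (x := of0 n a) h k
    rw [pow_succ, ih hk', cls_mul]
    congr 1
    rw [of0_mul, pow_succ]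

theorem of0_rho_pow_mul_mul (n : ℕ∞) (p q : ℕ) (x y : Cobar n) :
    of0 n (rho ^ p) * x * (of0 n (rho ^ q) * y) = of0 n (rho ^ (p + q)) * (x * y) := by
  rw [pow_add, ← of0_mul, mul_assoc, ← mul_assoc x, ← of0_rho_pow_comm, mul_assoc, mul_assoc]

/-- The cocycle that represents `v_i(j)`. -/
def vCochain (n : ℕ∞) (i j : ℕ) : Cobar n := of1 n (etaQuot n i (2 ^ i * (2 * j + 1)))

theorem diff_vCochain (n : ℕ∞) (i j : ℕ) : diff n (vCochain n i j) = 0 :=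
  diff_of1_etaQuot n (Dvd.intro _ rfl)

/-- Since powers of `ρ` can be cancelled, this equation characterizes the cocycle, and relations can
be derived by differentiating powers of `τ`. -/
theorem diff_tau_pow_eq (n : ℕ∞) {i j a : ℕ} (h : a = 2 ^ i * (2 * j + 1)) :
    diff n (of0 n (tau ^ a)) = of0 n (rho ^ rhoLen i) * vCochain n i j := by
  subst h
  exact diff_of0_tau_pow n (Dvd.intro _ rfl)

theorem vCochain_zero (n : ℕ∞) (i : ℕ) : vCochain n i 0 = of1 n (tauG n i) := by
  have h1 : bits (2 ^ i * (2 * 0 + 1)) = {i} := bits_eq (by simp [binVal])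
  have h2 : ({i} : Finset ℕ).powerset.erase ∅ = {{i}} := by
    ext S
    simp only [Finset.mem_erase, Finset.mem_powerset, Finset.subset_singleton_iff,
      Finset.mem_singleton]
    constructor
    · rintro ⟨h, h' | h'⟩
      · exact absurd h' h
      · exact h'
    · rintro rfl
      exact ⟨Finset.singleton_ne_empty i, Or.inr rfl⟩
  rw [vCochain, etaQuot, h1, h2, Finset.sum_singleton]
  simp [rhoWt, binVal]

theorem etaR_tau_pow_of_dvd {n : ℕ∞} {a : ℕ} (ha : ∀ i : ℕ, (i : ℕ∞) ≤ n → 2 ^ (i + 1) ∣ a) :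
    etaR n (tau ^ a) = etaL n (tau ^ a) := by
  rw [← sub_eq_zero, etaR_sub_etaL_tau_pow n (i := 0) (by simp), etaQuot_eq_zero, mul_zero]
  intro k hk
  by_contra hkn
  have := le_of_mem_bits (ha k (not_lt.1 hkn)) hk
  omega

theorem diff_of0_tau_pow_of_dvd {n : ℕ∞} {a : ℕ}
    (ha : ∀ i : ℕ, (i : ℕ∞) ≤ n → 2 ^ (i + 1) ∣ a) : diff n (of0 n (tau ^ a)) = 0 := by
  rw [diff_of0, etaR_tau_pow_of_dvd ha, sub_self, map_zero]

theorem of0_tau_pow_comm {n : ℕ∞} {a : ℕ} (ha : ∀ i : ℕ, (i : ℕ∞) ≤ n → 2 ^ (i + 1) ∣ a)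
    (x : Cobar n) : of0 n (tau ^ a) * x = x * of0 n (tau ^ a) := by
  induction x using cobar_induction with
  | h0 b => rw [of0_mul, of0_mul, mul_comm]
  | h1 g => rw [of0_mul_of1, of1_mul_of0, etaR_tau_pow_of_dvd ha]
  | hadd x y hx hy => rw [mul_add, add_mul, hx, hy]
  | hmul x y hx hy => rw [← mul_assoc, hx, mul_assoc, hy, mul_assoc]

/-- Write `A`, `B` for the two powers of `τ`. Up to a power of `ρ`, the product of the quotients in
`Γ` gives the cochain `dA · B - B · dA`, because right and left multiplication by `B` use the two
units. Its differential is `dA · dB - dB · dA`. -/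
theorem vCochain_comm (n : ℕ∞) (i j k l : ℕ) :
    vCochain n i j * vCochain n k l - vCochain n k l * vCochain n i j =
      diff n (of1 n (etaQuot n k (2 ^ k * (2 * l + 1)) * etaQuot n i (2 ^ i * (2 * j + 1)))) := by
  set a := 2 ^ i * (2 * j + 1) with ha
  set b := 2 ^ k * (2 * l + 1) with hb
  have hA := diff_tau_pow_eq n ha
  have hB := diff_tau_pow_eq n hb
  apply of0_rho_pow_cancel n (rhoLen i + rhoLen k)
  rw [mul_sub, ← of0_rho_pow_mul_mul, add_comm (rhoLen i), ← of0_rho_pow_mul_mul, ← hA, ← hB,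
    ← diff_of0_rho_pow_mul]
  have h1 : of0 n (rho ^ (rhoLen k + rhoLen i)) * of1 n (etaQuot n k b * etaQuot n i a) =
      diff n (of0 n (tau ^ a)) * of0 n (tau ^ b) - of0 n (tau ^ b) * diff n (of0 n (tau ^ a)) := by
    rw [diff_of0, of1_mul_of0, of0_mul_of1, of0_mul_of1, ← map_sub (of1 n), ← sub_mul,
      etaR_sub_etaL_tau_pow n (i := i) (Dvd.intro _ ha.symm),
      etaR_sub_etaL_tau_pow n (i := k) (Dvd.intro _ hb.symm), pow_add, map_mul (etaL n),
      mul_mul_mul_comm]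
  rw [h1, map_sub, diff_mul, diff_mul, diff_diff, mul_zero, zero_mul, add_zero, zero_add]

/-- With `D = τ^(2^(k+1) l)`, moving `D` from one factor to the other changes `dA · d(DB)` into
`d(AD) · dB`. By the Leibniz rule the difference is `dA · dD · B + A · dD · dB`, and this is `d(A ·
dD · B)`. -/
theorem vCochain_mul (n : ℕ∞) {i k : ℕ} (hik : i ≤ k) (j l : ℕ) :
    ∃ w, vCochain n i j * vCochain n k l -
      vCochain n i (j + 2 ^ (k - i) * l) * vCochain n k 0 = diff n w := by
  obtain ⟨m, rfl⟩ := Nat.exists_eq_add_of_le hik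
  rw [Nat.add_sub_cancel_left]
  set A := of0 n (tau ^ (2 ^ i * (2 * j + 1))) with hA
  set D := of0 n (tau ^ (2 ^ (i + m + 1) * l)) with hD
  set B := of0 n (tau ^ 2 ^ (i + m)) with hB
  set W := of1 n (etaQuot n (i + m + 1) (2 ^ (i + m + 1) * l)) with hW
  have dA : diff n A = of0 n (rho ^ rhoLen i) * vCochain n i j := diff_tau_pow_eq n rfl
  have dB : diff n B = of0 n (rho ^ rhoLen (i + m)) * vCochain n (i + m) 0 :=
    diff_tau_pow_eq n (by ring)
  have dD : diff n D = of0 n (rho ^ rhoLen (i + m + 1)) * W :=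
    diff_of0_tau_pow n (Dvd.intro _ rfl)
  have dW : diff n W = 0 := diff_of1_etaQuot n (Dvd.intro _ rfl)
  have dAD : diff n (A * D) = of0 n (rho ^ rhoLen i) * vCochain n i (j + 2 ^ m * l) := by
    rw [hA, hD, of0_mul, ← pow_add]
    exact diff_tau_pow_eq n (by ring)
  have dDB : diff n (D * B) = of0 n (rho ^ rhoLen (i + m)) * vCochain n (i + m) l := by
    rw [hD, hB, of0_mul, ← pow_add]
    exact diff_tau_pow_eq n (by ring)
  -- The factor `ρ` in `dD` has a high enough power to survive division by the two powers attached
  -- to `dA` and `dB`; the last bracket is what remains.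
  have hlen : rhoLen (i + m + 1) =
      rhoLen i + rhoLen (i + m) + (rhoLen (i + m) - rhoLen i + 1) := by
    have := rhoLen_strictMono.monotone (Nat.le_add_right i m)
    rw [rhoLen_succ]
    omega
  refine ⟨of0 n (rho ^ (rhoLen (i + m) - rhoLen i + 1)) * (A * (W * B)), ?_⟩
  apply of0_rho_pow_cancel n (rhoLen i + rhoLen (i + m))
  rw [mul_sub, ← of0_rho_pow_mul_mul, ← of0_rho_pow_mul_mul, ← dA, ← dDB, ← dAD, ← dB,
    ← diff_of0_rho_pow_mul, ← mul_assoc (of0 n (rho ^ _)), of0_mul n (rho ^ _) (rho ^ _), ← pow_add rho, ← hlen,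
    diff_of0_rho_pow_mul, diff_mul n A (W * B), diff_mul n W B, dW, zero_mul, add_zero, diff_mul n D,
    diff_mul n A D, mul_add, add_mul, mul_add, dD]
  have e1 : of0 n (rho ^ rhoLen (i + m + 1)) * (A * (W * diff n B)) =
      A * (of0 n (rho ^ rhoLen (i + m + 1)) * W) * diff n B := by
    rw [← mul_assoc, of0_rho_pow_comm, mul_assoc, mul_assoc, mul_assoc]
  have e2 : of0 n (rho ^ rhoLen (i + m + 1)) * (diff n A * (W * B)) =
      diff n A * (of0 n (rho ^ rhoLen (i + m + 1)) * W * B) := by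
    rw [← mul_assoc, of0_rho_pow_comm, mul_assoc, mul_assoc]
  rw [e1, e2, mul_assoc (diff n A) D, cobar_sub]
  have h0 := cobar_add_self n (diff n A * (D * diff n B))
  rw [← sub_eq_zero]
  calc _ = diff n A * (D * diff n B) + diff n A * (D * diff n B) := by abel
    _ = 0 := h0

/-- The power `τ^(2^(N+1))` is a cocycle, so it factors out of the differential of the corresponding
power of `τ`. -/
theorem vCochain_periodic {n : ℕ∞} {N : ℕ} (hN : n = N) {i : ℕ} (hi : i ≤ N) (j : ℕ) :
    vCochain n i (j + 2 ^ (N - i)) = of0 n (tau ^ 2 ^ (N + 1)) * vCochain n i j := by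
  obtain ⟨m, rfl⟩ := Nat.exists_eq_add_of_le hi
  rw [Nat.add_sub_cancel_left]
  have hT : ∀ k : ℕ, (k : ℕ∞) ≤ n → 2 ^ (k + 1) ∣ 2 ^ (i + m + 1) := by
    intro k hk
    rw [hN, Nat.cast_le] at hk
    exact pow_dvd_pow 2 (by omega)
  apply of0_rho_pow_cancel n (rhoLen i)
  rw [← diff_tau_pow_eq n rfl, ← mul_assoc, of0_rho_pow_comm, mul_assoc, ← diff_tau_pow_eq n rfl]
  have h2 : 2 ^ i * (2 * (j + 2 ^ m) + 1) = 2 ^ (i + m + 1) + 2 ^ i * (2 * j + 1) := by ring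
  rw [h2, pow_add, ← of0_mul, diff_mul, diff_of0_tau_pow_of_dvd hT, zero_mul, add_zero]

theorem dvd_two_pow_toNat {n : ℕ∞} (hn : n ≠ ⊤) (i : ℕ) (hi : (i : ℕ∞) ≤ n) :
    2 ^ (i + 1) ∣ 2 ^ (n.toNat + 1) := by
  rw [← ENat.natCast_toNat hn, Nat.cast_le] at hi
  exact pow_dvd_pow 2 (by omega)

theorem diff_of0_rho (n : ℕ∞) : diff n (of0 n rho) = 0 := by
  simpa using diff_of0_rho_pow n 1

/-- The classes that correspond to the generators. -/
def genCls (n : ℕ∞) : Gen n → Ext n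
  | Gen.rho => cls n (of0 n rho) (diff_of0_rho n)
  | Gen.tauPow hn => cls n (of0 n (tau ^ 2 ^ (n.toNat + 1)))
      (diff_of0_tau_pow_of_dvd (dvd_two_pow_toNat hn))
  | Gen.v i _ j => cls n (vCochain n i j) (diff_vCochain n i j)

theorem cls_comm_of_central {n : ℕ∞} {x y : Cobar n} (hx : diff n x = 0) (hy : diff n y = 0)
    (h : x * y = y * x) : cls n x hx * cls n y hy = cls n y hy * cls n x hx := by
  rw [cls_mul, cls_mul]
  congr 1

theorem genCls_comm (n : ℕ∞) (g g' : Gen n) :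
    genCls n g * genCls n g' = genCls n g' * genCls n g := by
  rcases g with _ | hn | ⟨i, hi, j⟩ <;> rcases g' with _ | hn' | ⟨k, hk, l⟩
  · rfl
  · exact cls_comm_of_central _ _ (of0_rho_comm n _)
  · exact cls_comm_of_central _ _ (of0_rho_comm n _)
  · exact cls_comm_of_central _ _ (of0_rho_comm n _).symm
  · rfl
  · exact cls_comm_of_central _ _ (of0_tau_pow_comm (dvd_two_pow_toNat hn) _)
  · exact cls_comm_of_central _ _ (of0_rho_comm n _).symm
  · exact cls_comm_of_central _ _ (of0_tau_pow_comm (dvd_two_pow_toNat hn') _).symm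
  · exact cls_eq _ _ _ (vCochain_comm n i j k l)

/-- Commutativity of `Ext` is not available in advance, so the evaluation is made in the commutative
subalgebra that the given elements generate. -/
theorem exists_aeval_of_comm {R A σ : Type*} [CommSemiring R] [Semiring A] [Algebra R A]
    (f : σ → A) (h : ∀ i j, f i * f j = f j * f i) :
    ∃ φ : MvPolynomial σ R →ₐ[R] A, ∀ i, φ (MvPolynomial.X i) = f i := by
  have hS : IsMulCommutative (Algebra.adjoin R (Set.range f)) :=
    Algebra.isMulCommutative_adjoin R (by
      rintro _ ⟨i, rfl⟩ _ ⟨j, rfl⟩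
      exact h i j)
  let _ : CommSemiring (Algebra.adjoin R (Set.range f)) :=
    { (Algebra.adjoin R (Set.range f)).toSemiring with mul_comm := hS.is_comm.comm }
  refine ⟨(Algebra.adjoin R (Set.range f)).val.comp
    (MvPolynomial.aeval fun i => ⟨f i, Algebra.subset_adjoin ⟨i, rfl⟩⟩), fun i => ?_⟩
  rw [AlgHom.comp_apply, MvPolynomial.aeval_X]
  rfl

theorem map_sub_eq_zero {F A B : Type*} [Ring A] [Semiring B] [FunLike F A B] [RingHomClass F A B]
    (φ : F) {x y : A} (h : φ x = φ y) : φ (x - y) = 0 := by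
  rw [sub_eq_add_neg, map_add, h, ← map_add, add_neg_cancel, map_zero]

/-- The homomorphism from the free algebra that sends the generators to their classes. -/
def freeHom (n : ℕ∞) : Free n →ₐ[ZMod 2] Ext n :=
  (exists_aeval_of_comm (genCls n) (genCls_comm n)).choose

theorem freeHom_X (n : ℕ∞) (g : Gen n) : freeHom n (MvPolynomial.X g) = genCls n g :=
  (exists_aeval_of_comm (genCls n) (genCls_comm n)).choose_spec g

theorem freeHom_rel (n : ℕ∞) (p : Free n) (hp : PresRel n p) : freeHom n p = 0 := by
  cases hp with
  | torsion i hi j =>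
    rw [map_mul, map_pow, freeHom_X, freeHom_X, genCls, genCls,
      cls_pow _ _ (diff_of0_rho_pow n _), cls_mul, cls_eq_zero_iff]
    exact ⟨_, (diff_tau_pow_eq n rfl).symm⟩
  | product i k hi hk hik j l =>
    apply map_sub_eq_zero
    rw [map_mul, map_mul, freeHom_X, freeHom_X, freeHom_X, freeHom_X]
    obtain ⟨w, hw⟩ := vCochain_mul n hik j l
    exact cls_eq _ _ w hw
  | periodic hn i hi j hj =>
    apply map_sub_eq_zero
    rw [map_mul, freeHom_X, freeHom_X, freeHom_X, genCls, genCls, genCls,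
      cls_mul]
    congr 1
    have hi' : i ≤ n.toNat := by
      rwa [← ENat.natCast_toNat hn, Nat.cast_le] at hi
    rw [← vCochain_periodic (ENat.natCast_toNat hn).symm hi', Nat.sub_add_cancel hj]

/-- The homomorphism from the presented algebra to `Ext`. -/
def presHom (n : ℕ∞) : Presented n →ₐ[ZMod 2] Ext n :=
  Ideal.Quotient.liftₐ _ (freeHom n) fun p hp => by
    induction hp using Submodule.span_induction with
    | mem p hp => exact freeHom_rel n p hp
    | zero => exact map_zero _
    | add x y _ _ hx hy => rw [map_add, hx, hy, add_zero]
    | smul a x _ hx => rw [smul_eq_mul, map_mul, hx, mul_zero]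

theorem presHom_gen (n : ℕ∞) (g : Gen n) : presHom n (gen n g) = genCls n g := by
  rw [← freeHom_X]
  rfl

/-! ### Normal forms in the presented algebra -/

theorem gen_rel {n : ℕ∞} {p : Free n} (hp : PresRel n p) :
    (Ideal.Quotient.mk _ p : Presented n) = 0 :=
  Ideal.Quotient.eq_zero_iff_mem.2 (Ideal.subset_span hp)

/-- The generator `v_i(j)`, or `0` if `i > n`. -/
def vGen (n : ℕ∞) (i j : ℕ) : Presented n :=
  open Classical in if h : (i : ℕ∞) ≤ n then gen n (Gen.v i h j) else 0

theorem vGen_of_le {n : ℕ∞} {i : ℕ} (h : (i : ℕ∞) ≤ n) (j : ℕ) :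
    vGen n i j = gen n (Gen.v i h j) := dif_pos h

theorem vGen_of_not_le {n : ℕ∞} {i : ℕ} (h : ¬ (i : ℕ∞) ≤ n) (j : ℕ) : vGen n i j = 0 := dif_neg h

/-- The power `τ ^ a` of `τ ^ (2 ^ (n + 1))`. -/
def tauGen (n : ℕ∞) (a : ℕ) : Presented n :=
  open Classical in if h : n ≠ ⊤ then gen n (Gen.tauPow h) ^ (a / 2 ^ (n.toNat + 1)) else 1

theorem rho_pow_mul_vGen (n : ℕ∞) (i j : ℕ) : gen n Gen.rho ^ rhoLen i * vGen n i j = 0 := by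
  by_cases hi : (i : ℕ∞) ≤ n
  · rw [vGen_of_le hi, ← gen_rel (PresRel.torsion i hi j)]
    simp only [gen, map_mul, map_pow]
    rfl
  · rw [vGen_of_not_le hi, mul_zero]

theorem vGen_mul_vGen {n : ℕ∞} {i k : ℕ} (hik : i ≤ k) (j l : ℕ) :
    vGen n i j * vGen n k l = vGen n i (j + 2 ^ (k - i) * l) * vGen n k 0 := by
  by_cases hk : (k : ℕ∞) ≤ n
  · have hi : (i : ℕ∞) ≤ n := (Nat.cast_le.2 hik).trans hk
    rw [vGen_of_le hk, vGen_of_le hk, vGen_of_le hi, vGen_of_le hi, ← sub_eq_zero,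
      ← gen_rel (PresRel.product i k hi hk hik j l)]
    simp only [gen, map_mul, map_sub]
  · rw [vGen_of_not_le hk, vGen_of_not_le hk, mul_zero, mul_zero]

theorem tauPow_mul_vGen {n : ℕ∞} (hn : n ≠ ⊤) (i j : ℕ) :
    gen n (Gen.tauPow hn) * vGen n i j = vGen n i (j + 2 ^ (n.toNat - i)) := by
  by_cases hi : (i : ℕ∞) ≤ n
  · have h := gen_rel (PresRel.periodic hn i hi (j + 2 ^ (n.toNat - i)) (Nat.le_add_left _ _))
    rw [Nat.add_sub_cancel, map_sub, map_mul, sub_eq_zero] at h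
    rw [vGen_of_le hi, vGen_of_le hi]
    exact h.symm
  · rw [vGen_of_not_le hi, vGen_of_not_le hi, mul_zero]

/-- Periodicity absorbs powers of the periodicity generator into `j`; for `n = ∞` the factor is `1`.
-/
theorem tauGen_mul_vGen (n : ℕ∞) (a i j : ℕ) : ∃ j', tauGen n a * vGen n i j = vGen n i j' := by
  unfold tauGen
  split_ifs with hn
  · generalize a / 2 ^ (n.toNat + 1) = q
    induction q with
    | zero => exact ⟨j, by rw [pow_zero, one_mul]⟩
    | succ q ih =>
      obtain ⟨j', hj'⟩ := ih
      exact ⟨_, by rw [pow_succ', mul_assoc, hj', tauPow_mul_vGen hn]⟩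
  · exact ⟨j, one_mul _⟩

/-- The normal form with the same index as a cocycle of the basis of the cohomology. -/
def Crit.nf {n : ℕ∞} : Crit n → Presented n
  | free p a _ => gen n Gen.rho ^ p * tauGen n a
  | torsion p i j l _ _ _ _ =>
      gen n Gen.rho ^ p * (vGen n i j * (l.map fun k => vGen n k 0).prod)

/-- Commutativity allows the trailing indices to be sorted, and too high a power of `ρ` gives zero
by torsion on the smallest index. -/
theorem vGen_mul_prod_mem_span (n : ℕ∞) (p i j : ℕ) (l : List ℕ) (hl : ∀ k ∈ l, i ≤ k) :
    gen n Gen.rho ^ p * (vGen n i j * (l.map fun k => vGen n k 0).prod) ∈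
      Submodule.span (ZMod 2) (Set.range (Crit.nf (n := n))) := by
  by_cases hi : (i : ℕ∞) ≤ n
  swap
  · rw [vGen_of_not_le hi, zero_mul, mul_zero]
    exact zero_mem _
  by_cases hln : ∀ k ∈ l, (k : ℕ∞) ≤ n
  swap
  · push Not at hln
    obtain ⟨k, hk, hkn⟩ := hln
    rw [List.prod_eq_zero (List.mem_map.2 ⟨k, hk, vGen_of_not_le (not_le.2 hkn) 0⟩), mul_zero,
      mul_zero]
    exact zero_mem _
  by_cases hp : p < rhoLen i
  · have hperm := List.perm_insertionSort (· ≤ ·) l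
    rw [← (hperm.map fun k => vGen n k 0).prod_eq]
    exact Submodule.subset_span ⟨Crit.torsion p i j (l.insertionSort (· ≤ ·)) hp hi
      (fun k hk => ⟨hl k (hperm.mem_iff.1 hk), hln k (hperm.mem_iff.1 hk)⟩)
      (List.pairwise_insertionSort (· ≤ ·) l), rfl⟩
  · have h := rho_pow_mul_vGen n i j
    rw [← Nat.sub_add_cancel (not_lt.1 hp), pow_add, mul_assoc, ← mul_assoc (_ ^ rhoLen i), h,
      zero_mul, mul_zero]
    exact zero_mem _

/-- The product relation keeps the smallest index in front and moves the whole twist onto it,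
leaving `v_k(0)` behind. -/
theorem gen_mul_nf_mem_span (n : ℕ∞) (g : Gen n) (x : Crit n) :
    gen n g * x.nf ∈ Submodule.span (ZMod 2) (Set.range (Crit.nf (n := n))) := by
  rcases x with ⟨p, a, ha⟩ | ⟨p, i, j, l, hp, hi, hl, hs⟩
  · rcases g with _ | hn | ⟨k, hk, m⟩
    · refine Submodule.subset_span ⟨Crit.free (p + 1) a ha, ?_⟩
      rw [Crit.nf, Crit.nf, pow_succ', mul_assoc]
    · refine Submodule.subset_span ⟨Crit.free p (a + 2 ^ (n.toNat + 1)) fun i hi =>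
        (ha i hi).add (dvd_two_pow_toNat hn i hi), ?_⟩
      rw [Crit.nf, Crit.nf, tauGen, tauGen, dif_pos hn, dif_pos hn,
        Nat.add_div_right _ (Nat.two_pow_pos _), pow_succ']
      ring
    · obtain ⟨m', hm'⟩ := tauGen_mul_vGen n a k m
      have := vGen_mul_prod_mem_span n p k m' [] (by simp)
      rw [List.map_nil, List.prod_nil, mul_one, ← hm', vGen_of_le hk] at this
      rwa [Crit.nf, mul_left_comm, mul_comm (gen n (Gen.v k hk m))]
  · rcases g with _ | hn | ⟨k, hk, m⟩
    · have := vGen_mul_prod_mem_span n (p + 1) i j l fun k hk => (hl k hk).1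
      rwa [pow_succ', mul_assoc] at this
    · have := vGen_mul_prod_mem_span n p i (j + 2 ^ (n.toNat - i)) l fun k hk => (hl k hk).1
      rwa [← tauPow_mul_vGen hn, mul_assoc, mul_left_comm] at this
    · rw [Crit.nf, ← vGen_of_le hk, mul_left_comm, ← mul_assoc (vGen n k m)]
      rcases le_total i k with hik | hki
      · rw [mul_comm (vGen n k m), vGen_mul_vGen hik, mul_assoc]
        refine vGen_mul_prod_mem_span n p i _ (k :: l) fun q hq => ?_
        rcases List.mem_cons.1 hq with rfl | hq
        · exact hik
        · exact (hl q hq).1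
      · rw [vGen_mul_vGen hki, mul_assoc]
        refine vGen_mul_prod_mem_span n p k _ (i :: l) fun q hq => ?_
        rcases List.mem_cons.1 hq with rfl | hq
        · exact hki
        · exact hki.trans (hl q hq).1

theorem nf_free_zero (n : ℕ∞) : (Crit.free (n := n) 0 0 fun _ _ => dvd_zero _).nf = 1 := by
  rw [Crit.nf, tauGen]
  split_ifs <;> simp

theorem span_nf (n : ℕ∞) : Submodule.span (ZMod 2) (Set.range (Crit.nf (n := n))) = ⊤ := by
  rw [eq_top_iff]
  rintro x -
  obtain ⟨p, rfl⟩ := Ideal.Quotient.mk_surjective x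
  induction p using MvPolynomial.induction_on with
  | C c =>
    have h : (Ideal.Quotient.mk _ (MvPolynomial.C c) : Presented n) = c • 1 := by
      rw [← map_one (Ideal.Quotient.mk _), MvPolynomial.C_eq_smul_one]
      rfl
    rw [h, ← nf_free_zero]
    exact Submodule.smul_mem _ _ (Submodule.subset_span ⟨_, rfl⟩)
  | add p q hp hq => rw [map_add]; exact add_mem hp hq
  | mul_X p g hp =>
    rw [map_mul, mul_comm]
    change gen n g * _ ∈ _
    generalize (Ideal.Quotient.mk _ p : Presented n) = y at hp
    induction hp using Submodule.span_induction with
    | mem x hx => obtain ⟨c, rfl⟩ := hx; exact gen_mul_nf_mem_span n g c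
    | zero => rw [mul_zero]; exact zero_mem _
    | add x y _ _ hx hy => rw [mul_add]; exact add_mem hx hy
    | smul c x _ hx => rw [mul_smul_comm]; exact Submodule.smul_mem _ _ hx

/-! ### The isomorphism -/

theorem presHom_vGen {n : ℕ∞} {i : ℕ} (hi : (i : ℕ∞) ≤ n) (j : ℕ) :
    presHom n (vGen n i j) = cls n (vCochain n i j) (diff_vCochain n i j) := by
  rw [vGen_of_le hi, presHom_gen, genCls]

theorem presHom_rho_pow (n : ℕ∞) (p : ℕ) :
    presHom n (gen n Gen.rho ^ p) = cls n (of0 n (rho ^ p)) (diff_of0_rho_pow n p) := by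
  rw [map_pow, presHom_gen, genCls, cls_pow]

theorem presHom_prod {n : ℕ∞} {l : List ℕ} (hl : ∀ k ∈ l, (k : ℕ∞) ≤ n) :
    presHom n (l.map fun k => vGen n k 0).prod =
      cls n (word n (l.map fun k => {k})) (diff_word_singletons n l) := by
  induction l with
  | nil => exact map_one _
  | cons k l ih =>
    rw [List.map_cons, List.prod_cons, map_mul, ih fun m hm => hl m (List.mem_cons_of_mem _ hm),
      presHom_vGen (hl k List.mem_cons_self), cls_mul]
    congr 1
    rw [List.map_cons, word_cons, vCochain_zero, eG_singleton]

theorem presHom_tauGen {n : ℕ∞} {a : ℕ} (ha : ∀ i : ℕ, (i : ℕ∞) ≤ n → 2 ^ (i + 1) ∣ a) :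
    presHom n (tauGen n a) = cls n (of0 n (tau ^ a)) (diff_of0_tau_pow_of_dvd ha) := by
  unfold tauGen
  split_ifs with hn
  · have hd : 2 ^ (n.toNat + 1) ∣ a := ha _ (ENat.natCast_toNat hn).le
    have hp : (tau ^ 2 ^ (n.toNat + 1)) ^ (a / 2 ^ (n.toNat + 1)) = tau ^ a := by
      rw [← pow_mul, Nat.mul_div_cancel' hd]
    rw [map_pow, presHom_gen, genCls, cls_pow _ _ (by rw [hp]; exact diff_of0_tau_pow_of_dvd ha)]
    congr 1
    rw [hp]
  -- For `n = ∞` every power of `2` divides `a`, so the only invariant power of `τ` is `1`.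
  · have h0 : a = 0 := by
      by_contra h
      rw [not_not] at hn
      have := Nat.le_of_dvd (Nat.pos_of_ne_zero h) (ha a (by rw [hn]; exact le_top))
      have h2 := Nat.lt_two_pow_self (n := a + 1)
      omega
    subst h0
    rw [map_one, ← cls_one]
    congr 1
    rw [pow_zero, of0_one]

theorem presHom_nf {n : ℕ∞} (x : Crit n) : presHom n x.nf = cls n x.rep (diff_rep x) := by
  rcases x with ⟨p, a, ha⟩ | ⟨p, i, j, l, hp, hi, hl, hs⟩
  · rw [Crit.nf, map_mul, presHom_rho_pow, presHom_tauGen ha, cls_mul]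
    congr 1
    rw [of0_mul, Crit.rep]
  · rw [Crit.nf, map_mul, map_mul, presHom_rho_pow, presHom_vGen hi,
      presHom_prod fun k hk => (hl k hk).2, cls_mul, cls_mul]
    rfl

theorem diff_linearCombination_rep {n : ℕ∞} (c : Crit n →₀ ZMod 2) :
    diff n (Finsupp.linearCombination (ZMod 2) Crit.rep c) = 0 := by
  rw [Finsupp.linearCombination_apply, Finsupp.sum, map_sum]
  exact Finset.sum_eq_zero fun x _ => by rw [map_smul, diff_rep, smul_zero]

theorem presHom_linearCombination {n : ℕ∞} (c : Crit n →₀ ZMod 2) :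
    presHom n (Finsupp.linearCombination (ZMod 2) Crit.nf c) =
      cls n (Finsupp.linearCombination (ZMod 2) Crit.rep c) (diff_linearCombination_rep c) := by
  classical
  induction c using Finsupp.induction_linear with
  | zero =>
    rw [map_zero, map_zero]
    refine ((cls_eq_zero_iff _).2 ⟨0, ?_⟩).symm
    rw [map_zero, map_zero]
  | add f g hf hg =>
    rw [map_add, map_add, hf, hg]
    refine Eq.trans (b := cls n (Finsupp.linearCombination (ZMod 2) Crit.rep f +
      Finsupp.linearCombination (ZMod 2) Crit.rep g) ?_) rfl ?_
    · rw [map_add, diff_linearCombination_rep, diff_linearCombination_rep, add_zero]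
    · congr 1
      rw [map_add]
  | single x a =>
    have ha : a = 0 ∨ a = 1 := by revert a; decide
    rcases ha with rfl | rfl
    · rw [Finsupp.single_zero, map_zero, map_zero]
      refine ((cls_eq_zero_iff _).2 ⟨0, ?_⟩).symm
      rw [map_zero, map_zero]
    · rw [Finsupp.linearCombination_single, one_smul, presHom_nf]
      congr 1
      rw [Finsupp.linearCombination_single, one_smul]

/-- The spanning normal forms go to the basis classes with the same indices: independence of the
latter gives injectivity, and spanning gives surjectivity. -/
theorem presHom_bijective (n : ℕ∞) : Function.Bijective (presHom n) := by
  obtain ⟨hspan, hindep⟩ := cobar_homology_basis n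
  have hnf : ∀ x, ∃ c, Finsupp.linearCombination (ZMod 2) (Crit.nf (n := n)) c = x := fun x => by
    have hx : x ∈ Submodule.span (ZMod 2) (Set.range (Crit.nf (n := n))) := by
      rw [span_nf]; trivial
    rwa [← Finsupp.range_linearCombination] at hx
  constructor
  · intro x y hxy
    rw [← sub_eq_zero]
    have h0 : presHom n (x - y) = 0 := map_sub_eq_zero _ hxy
    obtain ⟨c, hc⟩ := hnf (x - y)
    rw [← hc, presHom_linearCombination, cls_eq_zero_iff] at h0
    obtain ⟨w, hw⟩ := h0
    rw [← hc, hindep c w hw, map_zero]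
  · intro y
    obtain ⟨⟨z, hz⟩, rfl⟩ := (cohomologous n).mk'_surjective y
    obtain ⟨c, w, h⟩ := hspan z hz
    refine ⟨Finsupp.linearCombination (ZMod 2) Crit.nf c, ?_⟩
    rw [presHom_linearCombination]
    exact (cls_eq hz _ w (by rw [h, add_sub_cancel_left])).symm

/-! ### Degrees and detection -/

theorem GammaHomog.cast {n : ℕ∞} {t u t' u' : ℤ} {g : Gamma n} (h : GammaHomog n t u g)
    (ht : t = t') (hu : u = u') : GammaHomog n t' u' g := ht ▸ hu ▸ h

theorem GammaHomog.pow {n : ℕ∞} {t u : ℤ} {g : Gamma n} (h : GammaHomog n t u g) (k : ℕ) :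
    GammaHomog n (k * t) (k * u) (g ^ k) := by
  induction k with
  | zero => rw [pow_zero]; exact GammaHomog.one.cast (by simp) (by simp)
  | succ k ih =>
    rw [pow_succ]
    exact (ih.mul h).cast (by push_cast; ring) (by push_cast; ring)

theorem GammaHomog.sum {n : ℕ∞} {t u : ℤ} {ι : Type*} (s : Finset ι) (f : ι → Gamma n)
    (h : ∀ i ∈ s, GammaHomog n t u (f i)) : GammaHomog n t u (∑ i ∈ s, f i) :=
  Finset.sum_induction f _ (fun _ _ => GammaHomog.add) (GammaHomog.zero t u) h

theorem gammaHomog_eG (n : ℕ∞) (S : Finset ℕ) :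
    GammaHomog n (rhoWt S) (binVal S - S.card) (eG n S) := by
  classical
  induction S using Finset.induction_on with
  | empty => rw [eG_empty]; exact GammaHomog.one.cast (by simp [rhoWt]) (by simp [binVal])
  | insert i S hi ih =>
    have h : eG n (insert i S) = tauG n i * eG n S := Finset.prod_insert hi
    rw [h]
    refine ((GammaHomog.tauG i).mul ih).cast ?_ ?_
    · have h1 : rhoWt (insert i S) = rhoLen i + rhoWt S := Finset.sum_insert hi
      have h2 : (rhoLen i : ℤ) + 1 = 2 ^ (i + 1) := by exact_mod_cast rhoLen_add_one i
      rw [h1]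
      push_cast
      linarith
    · have h1 : binVal (insert i S) = 2 ^ i + binVal S := Finset.sum_insert hi
      rw [h1, Finset.card_insert_of_notMem hi]
      push_cast
      ring

/-- By `rhoWt_add_card`, the bidegree of each summand does not depend on the subset `S`. -/
theorem gammaHomog_etaQuot (n : ℕ∞) {i a : ℕ} (h : 2 ^ i ∣ a) :
    GammaHomog n (2 ^ (i + 1) - 1) (2 ^ (i + 1) - 1 - a) (etaQuot n i a) := by
  refine GammaHomog.sum _ _ fun S hS => ?_
  have e0 := rhoLen_le_rhoWt_of_dvd h hS
  rw [Finset.mem_erase, Finset.mem_powerset] at hS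
  have e1 : (rhoWt S : ℤ) + S.card = 2 * binVal S := by exact_mod_cast rhoWt_add_card S
  have e2 : (binVal (bits a \ S) : ℤ) + binVal S = a := by
    exact_mod_cast (binVal_sdiff_add hS.2).trans (binVal_bits a)
  have e3 : (rhoLen i : ℤ) + 1 = 2 ^ (i + 1) := by exact_mod_cast rhoLen_add_one i
  rw [← etaL_mul_eq_smul, map_mul, map_pow, map_pow]
  refine (((GammaHomog.rho.pow _).mul (GammaHomog.tau.pow _)).mul (gammaHomog_eG n S)).cast ?_ ?_
  · rw [Nat.cast_sub e0]
    linarith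
  · rw [Nat.cast_sub e0]
    linarith

theorem vCochain_hasTridegree (n : ℕ∞) (i j : ℕ) :
    HasTridegree n (2 ^ (i + 1) - 2) 1 (2 ^ i - 1 - 2 ^ (i + 1) * j)
      (cls n (vCochain n i j) (diff_vCochain n i j)) := by
  refine ⟨vCochain n i j, CobarHomog.of1 ((gammaHomog_etaQuot n (Dvd.intro _ rfl)).cast ?_ ?_),
    cls_represents _⟩
  · push_cast; ring
  · push_cast; ring

theorem vCochain_detectedBy (n : ℕ∞) (i j : ℕ) :
    DetectedBy n (cls n (vCochain n i j) (diff_vCochain n i j))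
      (of0 n (tau ^ (2 ^ (i + 1) * j)) * of1 n (tauG n i)) := by
  refine ⟨vCochain n i j, cls_represents _, 0, ?_⟩
  have hi : i ∉ bits (2 ^ (i + 1) * j) := fun h =>
    absurd (le_of_mem_bits (Dvd.intro _ rfl) h) (by omega)
  have hb := bits_two_pow_mul_odd i j
  have hmem : ({i} : Finset ℕ) ∈ (bits (2 ^ i * (2 * j + 1))).powerset.erase ∅ := by
    simp [hb]
  have hd : bits (2 ^ i * (2 * j + 1)) \ {i} = bits (2 ^ (i + 1) * j) := by
    rw [hb, Finset.sdiff_singleton_eq_erase, Finset.erase_insert hi]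
  -- Every subset other than `{i}` has `rhoWt` greater than `rhoLen i`, so one more factor `ρ` can
  -- be split off and no coboundary correction is needed.
  refine ⟨∑ S ∈ ((bits (2 ^ i * (2 * j + 1))).powerset.erase ∅).erase {i},
    of1 n ((rho ^ (rhoWt S - rhoLen i - 1) * tau ^ binVal (bits (2 ^ i * (2 * j + 1)) \ S)) •
      eG n S), ?_⟩
  rw [vCochain, etaQuot, ← Finset.add_sum_erase _ _ hmem, hd, binVal_bits, map_add, of1_smul,
    eG_singleton, show rhoWt {i} = rhoLen i by simp [rhoWt], Nat.sub_self, pow_zero, one_mul,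
    add_sub_cancel_left, map_zero, zero_add, map_sum, Finset.mul_sum]
  refine Finset.sum_congr rfl fun S hS => ?_
  simp only [Finset.mem_erase, Finset.mem_powerset] at hS
  have e3 := rhoLen_lt_rhoWt (Finset.nonempty_iff_ne_empty.2 hS.2.1) hS.1 fun k hk =>
    le_of_mem_bits (Dvd.intro _ rfl) (hS.2.2 hk)
  rw [of1_smul, of1_smul, ← mul_assoc, of0_mul, ← mul_assoc, ← pow_succ',
    show rhoWt S - rhoLen i - 1 + 1 = rhoWt S - rhoLen i by omega]

end RealMotivic
end

theorem mainTheorem1 (n : ℕ∞) :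
    ∃ Φ : RealMotivic.Presented n ≃ₐ[ZMod 2] RealMotivic.Ext n,
      RealMotivic.Represents n (RealMotivic.of0 n RealMotivic.rho)
        (Φ (RealMotivic.gen n RealMotivic.Gen.rho)) ∧
      (∀ hn : n ≠ ⊤,
        RealMotivic.Represents n (RealMotivic.of0 n (RealMotivic.tau ^ 2 ^ (n.toNat + 1)))
          (Φ (RealMotivic.gen n (RealMotivic.Gen.tauPow hn)))) ∧
      ∀ (i : ℕ) (hi : (i : ℕ∞) ≤ n) (j : ℕ),
        RealMotivic.HasTridegree n (2 ^ (i + 1) - 2) 1 (2 ^ i - 1 - 2 ^ (i + 1) * j)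
          (Φ (RealMotivic.gen n (RealMotivic.Gen.v i hi j))) ∧
        RealMotivic.DetectedBy n (Φ (RealMotivic.gen n (RealMotivic.Gen.v i hi j)))
          (RealMotivic.of0 n (RealMotivic.tau ^ (2 ^ (i + 1) * j)) *
            RealMotivic.of1 n (RealMotivic.tauG n i)) := by
  have key : ∀ g, AlgEquiv.ofBijective (RealMotivic.presHom n) (RealMotivic.presHom_bijective n)
      (RealMotivic.gen n g) = RealMotivic.genCls n g := RealMotivic.presHom_gen n
  refine ⟨AlgEquiv.ofBijective (RealMotivic.presHom n) (RealMotivic.presHom_bijective n),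
    ?_, fun hn => ?_, fun i hi j => ?_⟩
  · rw [key]
    exact RealMotivic.cls_represents _
  · rw [key]
    exact RealMotivic.cls_represents _
  · rw [key]
    exact ⟨RealMotivic.vCochain_hasTridegree n i j, RealMotivic.vCochain_detectedBy n i j⟩
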